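/- Let $n\ge 1$ and let $H=(H_1,\dots,H_n)$ with $H_1,\dots,H_n\in\mathbb C[x]=\mathbb C[x_1,\dots,x_n]$ all homogeneous of the same degree (zero components being allowed). Suppose that $x+H$ is a quasi-translation, that is, the polynomial map $x-H$ is the inverse of $x+H$, and that $\deg H=\max_i\deg H_i\ge 1$. Let $\operatorname{rk}\mathcal JH$ denote the rank of the Jacobian matrix $\mathcal JH=(\partial H_i/\partial x_j)_{i,j}$ over $\mathbb C(x)$, let $V(H)\subseteq\mathbb C^n$ be the set of common zeroes of $H_1,\dots,H_n$, with $\dim V(H)$ its dimension as an algebraic set, and call a linear form $l\in\mathbb C[x]$ a linear invariant of $x+H$ if $l(x+H)=l(x)$. (i) If $\operatorname{rk}\mathcal JH\le 1$, then the image of $H:\mathbb C^n\to\mathbb C^n$ is a line through the origin and $x+H$ has $n-1$ linearly independent linear invariants. (ii) If $\gcd\{H_1,\dots,H_n\}=1$, then $2\le\operatorname{rk}\mathcal JH\le\dim V(H)\le n-2$. (iii) If $\operatorname{rk}\mathcal JH=2$, then $x+H$ has at least two linearly independent linear invariants. -/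

import Mathlib

open MvPolynomial

noncomputable section

namespace QuasiTranslation

/-- A polynomial map from complex affine `n`-space to itself, given by its components. -/
abbrev PolyMap (n : ℕ) : Type := Fin n → MvPolynomial (Fin n) ℂ

/-- Substitution `f(F)` of a polynomial map `F` into a polynomial `f`. -/
def subst {n : ℕ} (F : PolyMap n) (f : MvPolynomial (Fin n) ℂ) : MvPolynomial (Fin n) ℂ :=
  bind₁ F f

/-- The composition `G ∘ F`, that is, `G(F(x))`. -/
def comp {n : ℕ} (G F : PolyMap n) : PolyMap n := fun i => subst F (G i)

/-- The identity polynomial map `x`. -/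
def idMap (n : ℕ) : PolyMap n := fun i => X i

/-- `x + H` is a quasi-translation: the polynomial maps `x - H` and `x + H` are inverse
to each other. -/
def IsQuasiTranslation {n : ℕ} (H : PolyMap n) : Prop :=
  comp (idMap n - H) (idMap n + H) = idMap n ∧ comp (idMap n + H) (idMap n - H) = idMap n

/-- All components of `H` are homogeneous of one and the same degree (the zero polynomial being
homogeneous of every degree). -/
def IsHomogeneousMap {n : ℕ} (H : PolyMap n) : Prop :=
  ∃ d : ℕ, ∀ i, (H i).IsHomogeneous d

/-- `deg H`, the maximum of the degrees of the components
(zero polynomials are counted with degree `0`). -/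
def degree {n : ℕ} (H : PolyMap n) : ℕ :=
  Finset.univ.sup fun i => (H i).totalDegree

/-- The Jacobian matrix of `H` with respect to `x`. -/
def jacobian {n : ℕ} (H : PolyMap n) : Matrix (Fin n) (Fin n) (MvPolynomial (Fin n) ℂ) :=
  Matrix.of fun i j => pderiv j (H i)

/-- The rank of the Jacobian matrix over the field of rational functions. -/
def rankJacobian {n : ℕ} (H : PolyMap n) : ℕ :=
  ((jacobian H).map
    (algebraMap (MvPolynomial (Fin n) ℂ) (FractionRing (MvPolynomial (Fin n) ℂ)))).rank

/-- The set of values of `H`. -/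
def image {n : ℕ} (H : PolyMap n) : Set (Fin n → ℂ) :=
  Set.range fun (a : Fin n → ℂ) (i : Fin n) => eval a (H i)

/-- `V(H)`, the set of common zeroes of the components of `H`. -/
def zeroSet {n : ℕ} (H : PolyMap n) : Set (Fin n → ℂ) :=
  {a | ∀ i, eval a (H i) = 0}

/-- The dimension of an algebraic set `V` in affine space: the Krull dimension of its coordinate
ring `ℂ[x] / I(V)`. -/
def dim {n : ℕ} (V : Set (Fin n → ℂ)) : WithBot ℕ∞ :=
  ringKrullDim (MvPolynomial (Fin n) ℂ ⧸ vanishingIdeal ℂ V)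

/-- `gcd(H₁, …, Hₙ) = 1`: every common divisor of the components is a unit. -/
def GcdEqOne {n : ℕ} (H : PolyMap n) : Prop :=
  ∀ g : MvPolynomial (Fin n) ℂ, (∀ i, g ∣ H i) → IsUnit g

/-- A linear form `l` with `l(x + H) = l(x)`. -/
def IsLinearInvariant {n : ℕ} (H : PolyMap n) (l : MvPolynomial (Fin n) ℂ) : Prop :=
  l.IsHomogeneous 1 ∧ subst (idMap n + H) l = l

/-- `x + H` has (at least) `k` linearly independent linear invariants. -/
def HasIndependentLinearInvariants {n : ℕ} (H : PolyMap n) (k : ℕ) : Prop :=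
  ∃ l : Fin k → MvPolynomial (Fin n) ℂ,
    LinearIndependent ℂ l ∧ ∀ j, IsLinearInvariant H (l j)

end QuasiTranslation

end

/-! Two facts drive everything. First, gradients detect algebraic dependence: a polynomial algebraic
over a subalgebra has its gradient in the span of the gradients of that subalgebra
(`grad_mem_of_isAlgebraic`). Secondly, iterating the quasi-translation gives H(x + tH) = H(x), and
homogeneity turns this into H(H(x)) = 0.

For (i), forms of equal positive degree with proportional gradients are proportional, so H is a form
times a constant vector. For (ii), H(H) = 0 makes ℂ[H] a quotient of the coordinate ring of V(H),
whose dimension therefore bounds the rank; coprimality keeps V(H) from containing a hypersurface.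

For (iii), rank 2 makes the ratios of the H_i generate a field of transcendence degree one.
Restriction to a line embeds it in ℂ(T), and Lüroth's theorem makes all ratios rational functions of
a single p/q, with p, q coprime forms of equal degree (`exists_binaryForm`). Factors of invariants
are invariant, so p and q are killed by D_H, the derivation ∑ H_i ∂_i. Write H = γK with K having
coprime components. Modulo the member f = q(y)p - p(y)q of the pencil, K is proportional to the
constant vector K(y); hence f divides D_{K(y)} f, which has smaller degree and so vanishes.
Comparing two generic points shows that all second derivatives of p and q along values of K vanish,
and Euler's identity then makes p and q vanish on the span of the image of K. Coprime forms cannot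
vanish on a hyperplane, so this span has codimension at least two, and linear forms vanishing on it
are invariants. -/

noncomputable section

namespace QuasiTranslation

variable {n : ℕ}

/-! ### Gradients and algebraic dependence -/

/-- The gradient of a polynomial, with entries in the field of rational functions. -/
def grad (f : MvPolynomial (Fin n) ℂ) : Fin n → FractionRing (MvPolynomial (Fin n) ℂ) :=
  fun j => algebraMap _ _ (pderiv j f)

theorem grad_add (f g : MvPolynomial (Fin n) ℂ) : grad (f + g) = grad f + grad g := by
  ext j; simp [grad]

theorem grad_C (c : ℂ) : grad (C c : MvPolynomial (Fin n) ℂ) = 0 := by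
  ext j; simp [grad]

theorem grad_mul (f g : MvPolynomial (Fin n) ℂ) :
    grad (f * g) =
      algebraMap (MvPolynomial (Fin n) ℂ) (FractionRing (MvPolynomial (Fin n) ℂ)) f • grad g +
      algebraMap (MvPolynomial (Fin n) ℂ) (FractionRing (MvPolynomial (Fin n) ℂ)) g • grad f := by
  ext j
  simp only [grad, pderiv_mul, map_add, map_mul, Pi.add_apply, Pi.smul_apply, smul_eq_mul]
  ring

theorem grad_X (i : Fin n) : grad (X i : MvPolynomial (Fin n) ℂ) = Pi.single i 1 := by
  classical
  ext j
  simp only [grad, pderiv_X, Pi.single_apply]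
  split_ifs <;> simp_all

theorem grad_pow (f : MvPolynomial (Fin n) ℂ) (k : ℕ) :
    grad (f ^ k) = algebraMap (MvPolynomial (Fin n) ℂ) (FractionRing (MvPolynomial (Fin n) ℂ))
      ((k : MvPolynomial (Fin n) ℂ) * f ^ (k - 1)) • grad f := by
  ext j
  simp [grad, mul_assoc]

/-- The polynomials whose gradient lies in a given subspace. -/
def gradSubalgebra (W : Submodule (FractionRing (MvPolynomial (Fin n) ℂ))
    (Fin n → FractionRing (MvPolynomial (Fin n) ℂ))) : Subalgebra ℂ (MvPolynomial (Fin n) ℂ) where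
  carrier := {f | grad f ∈ W}
  mul_mem' {a b} ha hb := by
    rw [Set.mem_ofPred_eq, grad_mul]
    exact W.add_mem (W.smul_mem _ hb) (W.smul_mem _ ha)
  add_mem' {a b} ha hb := by
    rw [Set.mem_ofPred_eq, grad_add]
    exact W.add_mem ha hb
  algebraMap_mem' c := by
    rw [Set.mem_ofPred_eq, algebraMap_eq, grad_C]
    exact W.zero_mem

/-- Differentiate a relation P(f) = 0: modulo `W` only P'(f) · grad f survives, as the coefficients
have gradients in `W`. If P'(f) = 0, the derivative is a relation of smaller degree, nonzero in
characteristic zero. -/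
theorem grad_mem_of_isAlgebraic {W : Submodule (FractionRing (MvPolynomial (Fin n) ℂ))
    (Fin n → FractionRing (MvPolynomial (Fin n) ℂ))} {A : Subalgebra ℂ (MvPolynomial (Fin n) ℂ)}
    (hA : A ≤ gradSubalgebra W) {f : MvPolynomial (Fin n) ℂ} (hf : IsAlgebraic A f) :
    grad f ∈ W := by
  have chain : ∀ P : Polynomial A, grad (Polynomial.aeval f P) -
      algebraMap (MvPolynomial (Fin n) ℂ) (FractionRing (MvPolynomial (Fin n) ℂ))
        (Polynomial.aeval f (Polynomial.derivative P)) • grad f ∈ W := by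
    intro P
    induction P using Polynomial.induction_on' with
    | add P Q hP hQ =>
      simp only [map_add, grad_add, add_smul]
      convert W.add_mem hP hQ using 1
      abel
    | monomial k a =>
      have ha : grad (algebraMap A (MvPolynomial (Fin n) ℂ) a) ∈ W := hA a.2
      rw [Polynomial.aeval_monomial, Polynomial.derivative_monomial, Polynomial.aeval_monomial,
        map_mul (algebraMap A (MvPolynomial (Fin n) ℂ)), map_natCast]
      generalize algebraMap A (MvPolynomial (Fin n) ℂ) a = b at ha
      rw [grad_mul, grad_pow, smul_smul, ← map_mul, ← mul_assoc, add_sub_right_comm, sub_self,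
        zero_add]
      exact W.smul_mem _ ha
  obtain ⟨P, hP, hPf⟩ := hf
  induction hN : P.natDegree using Nat.strong_induction_on generalizing P with
  | _ N ih =>
    by_cases hd : Polynomial.aeval f (Polynomial.derivative P) = 0
    · rcases Nat.eq_zero_or_pos P.natDegree with h0 | h0
      · rw [Polynomial.eq_C_of_natDegree_eq_zero h0, Polynomial.aeval_C] at hPf
        exfalso
        apply hP
        rw [Polynomial.eq_C_of_natDegree_eq_zero h0]
        have : P.coeff 0 = 0 := Subtype.ext hPf
        rw [this, Polynomial.C_0]
      · refine ih _ (hN ▸ Polynomial.natDegree_derivative_lt h0.ne') _ ?_ hd rfl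
        intro h
        exact h0.ne' (Polynomial.derivative_eq_zero.mp h)
    · have := chain P
      rw [hPf] at this
      have h0 : grad (0 : MvPolynomial (Fin n) ℂ) = 0 := by simpa using grad_C (n := n) 0
      rw [h0, zero_sub, Submodule.neg_mem_iff] at this
      have hd' := (map_ne_zero_iff _ (IsFractionRing.injective (MvPolynomial (Fin n) ℂ)
        (FractionRing (MvPolynomial (Fin n) ℂ)))).mpr hd
      exact (W.smul_mem_iff hd').mp this

/-- The gradients of algebraically independent polynomials are linearly independent. -/
theorem linearIndependent_grad {ι : Type*} {x : ι → MvPolynomial (Fin n) ℂ}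
    (hx : AlgebraicIndependent ℂ x) :
    LinearIndependent (FractionRing (MvPolynomial (Fin n) ℂ)) (fun i => grad (x i)) := by
  -- A transcendence basis has n elements, and every variable is algebraic over it. Hence its n
  -- gradients span the n-dimensional space, and so are independent.
  obtain ⟨t, hst, ht⟩ := exists_isTranscendenceBasis_superset hx.coe_range
  have hcard : Cardinal.mk t = n := by
    rw [ht.cardinalMk_eq_trdeg, MvPolynomial.trdeg_of_isDomain]
    simp
  have : Finite t := by
    rw [← Cardinal.lt_aleph0_iff_finite, hcard]
    exact Cardinal.natCast_lt_aleph0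
  have : Fintype t := Fintype.ofFinite t
  have hcard' : Fintype.card t = n := by
    rw [Cardinal.mk_fintype] at hcard
    exact_mod_cast hcard
  have hli : LinearIndependent (FractionRing (MvPolynomial (Fin n) ℂ))
      (fun i : t => grad (i : MvPolynomial (Fin n) ℂ)) := by
    refine linearIndependent_of_top_le_span_of_card_eq_finrank ?_ (by simp [hcard'])
    set W := Submodule.span (FractionRing (MvPolynomial (Fin n) ℂ))
      (Set.range fun i : t => grad (i : MvPolynomial (Fin n) ℂ))
    have hA : Algebra.adjoin ℂ (Set.range ((↑) : t → MvPolynomial (Fin n) ℂ)) ≤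
        gradSubalgebra W := by
      rw [Algebra.adjoin_le_iff]
      rintro _ ⟨i, rfl⟩
      exact Submodule.subset_span ⟨i, rfl⟩
    rw [← (Pi.basisFun (FractionRing (MvPolynomial (Fin n) ℂ)) (Fin n)).span_eq,
      Submodule.span_le]
    rintro _ ⟨i, rfl⟩
    rw [Pi.basisFun_apply, ← grad_X]
    exact grad_mem_of_isAlgebraic hA (ht.isAlgebraic.isAlgebraic (X i))
  exact hli.comp (fun i => (⟨x i, hst ⟨i, rfl⟩⟩ : t))
    fun i j hij => hx.injective (congrArg Subtype.val hij)

theorem rankJacobian_eq_finrank (H : PolyMap n) :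
    rankJacobian H = Module.finrank (FractionRing (MvPolynomial (Fin n) ℂ))
      (Submodule.span (FractionRing (MvPolynomial (Fin n) ℂ))
        (Set.range fun i => grad (H i))) := by
  rw [rankJacobian, Matrix.rank_eq_finrank_span_row]
  rfl

/-! ### Homogeneity of factors -/

/-- The homomorphism `f(x) ↦ f(T x)`. -/
def scaleHom (n : ℕ) : MvPolynomial (Fin n) ℂ →ₐ[ℂ] Polynomial (MvPolynomial (Fin n) ℂ) :=
  aeval fun i => Polynomial.C (X i) * Polynomial.X

theorem scaleHom_monomial (s : Fin n →₀ ℕ) (c : ℂ) :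
    scaleHom n (monomial s c) = Polynomial.C (monomial s c) * Polynomial.X ^ s.degree := by
  rw [scaleHom, aeval_monomial, monomial_eq (s := s), Finsupp.degree]
  simp only [mul_pow, Finsupp.prod, Finset.prod_mul_distrib, map_mul, map_prod, map_pow,
    Finset.prod_pow_eq_pow_sum, mul_assoc]
  rfl

theorem scaleHom_of_isHomogeneous {f : MvPolynomial (Fin n) ℂ} {d : ℕ} (hf : f.IsHomogeneous d) :
    scaleHom n f = Polynomial.C f * Polynomial.X ^ d := by
  conv_lhs => rw [f.as_sum]
  conv_rhs => rw [f.as_sum]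
  rw [map_sum, map_sum, Finset.sum_mul]
  refine Finset.sum_congr rfl fun s hs => ?_
  rw [scaleHom_monomial, hf.degree_eq_sum_deg_support hs]
  rfl

theorem coeff_scaleHom (f : MvPolynomial (Fin n) ℂ) (k : ℕ) :
    (scaleHom n f).coeff k = homogeneousComponent k f := by
  conv_lhs => rw [← sum_homogeneousComponent f]
  rw [map_sum, Polynomial.finsetSum_coeff]
  simp_rw [scaleHom_of_isHomogeneous (homogeneousComponent_isHomogeneous _ f),
    Polynomial.coeff_C_mul_X_pow]
  rw [Finset.sum_ite_eq]
  split_ifs with h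
  · rfl
  · rw [homogeneousComponent_eq_zero]
    simpa using h

theorem scaleHom_injective : Function.Injective (scaleHom n) := by
  rw [injective_iff_map_eq_zero]
  intro f hf
  rw [← sum_homogeneousComponent f]
  exact Finset.sum_eq_zero fun k _ => by rw [← coeff_scaleHom, hf, Polynomial.coeff_zero]

theorem isHomogeneous_of_scaleHom {f : MvPolynomial (Fin n) ℂ} {d : ℕ}
    (h1 : (scaleHom n f).natDegree = d) (h2 : (scaleHom n f).natTrailingDegree = d) :
    f.IsHomogeneous d := by
  have : f = homogeneousComponent d f := by
    conv_lhs => rw [← sum_homogeneousComponent f]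
    by_cases hd : d ∈ Finset.range (f.totalDegree + 1)
    · refine Finset.sum_eq_single_of_mem d hd fun k _ hk => ?_
      rw [← coeff_scaleHom]
      rcases lt_or_gt_of_ne hk with h | h
      · exact Polynomial.coeff_eq_zero_of_lt_natTrailingDegree (h2 ▸ h)
      · exact Polynomial.coeff_eq_zero_of_natDegree_lt (h1 ▸ h)
    · have hd' : f.totalDegree < d := by simpa using hd
      rw [homogeneousComponent_eq_zero d f hd']
      refine Finset.sum_eq_zero fun k hk => ?_
      rw [← coeff_scaleHom]
      refine Polynomial.coeff_eq_zero_of_lt_natTrailingDegree (h2 ▸ ?_)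
      simp only [Finset.mem_range] at hk
      omega
  rw [this]
  exact homogeneousComponent_isHomogeneous d f

/-- Factors of nonzero homogeneous polynomials are homogeneous. -/
theorem exists_isHomogeneous_of_mul {f g : MvPolynomial (Fin n) ℂ} {d : ℕ}
    (h : (f * g).IsHomogeneous d) (h0 : f * g ≠ 0) :
    ∃ a b, a + b = d ∧ f.IsHomogeneous a ∧ g.IsHomogeneous b := by
  have hf : scaleHom n f ≠ 0 :=
    (map_ne_zero_iff _ scaleHom_injective).mpr (left_ne_zero_of_mul h0)
  have hg : scaleHom n g ≠ 0 :=
    (map_ne_zero_iff _ scaleHom_injective).mpr (right_ne_zero_of_mul h0)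
  have key := scaleHom_of_isHomogeneous h
  rw [map_mul] at key
  have e1 := congrArg Polynomial.natDegree key
  have e2 := congrArg Polynomial.natTrailingDegree key
  rw [Polynomial.natDegree_mul hf hg, Polynomial.natDegree_C_mul_X_pow _ _ h0] at e1
  rw [Polynomial.natTrailingDegree_mul hf hg,
    Polynomial.natTrailingDegree_mul (Polynomial.C_ne_zero.mpr h0) (pow_ne_zero _ Polynomial.X_ne_zero),
    Polynomial.natTrailingDegree_C, Polynomial.natTrailingDegree_X_pow, zero_add] at e2
  -- Degrees and trailing degrees in T both add up to d; as neither trailing degree exceeds the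
  -- degree, they agree for each factor.
  have i1 := Polynomial.natTrailingDegree_le_natDegree (scaleHom n f)
  have i2 := Polynomial.natTrailingDegree_le_natDegree (scaleHom n g)
  exact ⟨_, _, e1, isHomogeneous_of_scaleHom rfl (by omega),
    isHomogeneous_of_scaleHom rfl (by omega)⟩

theorem eq_zero_of_dvd_of_isHomogeneous {f g : MvPolynomial (Fin n) ℂ} {a b : ℕ}
    (hf : f.IsHomogeneous a) (hf0 : f ≠ 0) (hg : g.IsHomogeneous b) (hba : b < a) (h : f ∣ g) :
    g = 0 := by
  by_contra hg0
  have := totalDegree_le_of_dvd_of_isDomain h hg0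
  rw [hf.totalDegree hf0, hg.totalDegree hg0] at this
  omega

theorem exists_eq_C_of_isHomogeneous_zero {f : MvPolynomial (Fin n) ℂ} (hf : f.IsHomogeneous 0) :
    ∃ c, f = C c :=
  ⟨_, totalDegree_eq_zero_iff_eq_C.mp ((totalDegree_zero_iff_isHomogeneous _).mpr hf)⟩

/-! ### Euler's identity and proportional gradients -/

/-- The Euler identity in gradient form. -/
theorem sum_X_mul_grad {f : MvPolynomial (Fin n) ℂ} {d : ℕ} (hf : f.IsHomogeneous d) :
    ∑ j, algebraMap (MvPolynomial (Fin n) ℂ) (FractionRing (MvPolynomial (Fin n) ℂ)) (X j) *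
      grad f j = d * algebraMap (MvPolynomial (Fin n) ℂ) (FractionRing (MvPolynomial (Fin n) ℂ)) f := by
  simp only [grad, ← map_mul, ← map_sum]
  rw [hf.sum_X_mul_pderiv, nsmul_eq_mul, map_mul, map_natCast]

theorem eq_zero_of_forall_pderiv_eq_zero {f : MvPolynomial (Fin n) ℂ} {d : ℕ}
    (hf : f.IsHomogeneous d) (hd : d ≠ 0) (h : ∀ j, pderiv j f = 0) : f = 0 := by
  have := hf.sum_X_mul_pderiv
  simp only [h, mul_zero, Finset.sum_const_zero] at this
  exact (smul_eq_zero.mp this.symm).resolve_left hd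

/-- Homogeneous polynomials of the same positive degree with proportional gradients are
proportional. -/
theorem exists_eq_C_mul_of_grad_eq_smul {f g : MvPolynomial (Fin n) ℂ} {d : ℕ} (hd : d ≠ 0)
    (hf : f.IsHomogeneous d) (hg : g.IsHomogeneous d) (hg0 : g ≠ 0)
    {l : FractionRing (MvPolynomial (Fin n) ℂ)} (h : grad f = l • grad g) :
    ∃ c, f = C c * g := by
  by_cases hf0 : f = 0
  · exact ⟨0, by simp [hf0]⟩
  -- Euler's identity forces the proportionality factor to be f/g.
  have hl : algebraMap (MvPolynomial (Fin n) ℂ) (FractionRing (MvPolynomial (Fin n) ℂ)) f =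
      l * algebraMap (MvPolynomial (Fin n) ℂ) (FractionRing (MvPolynomial (Fin n) ℂ)) g := by
    have h1 := sum_X_mul_grad hf
    rw [h] at h1
    simp only [Pi.smul_apply, smul_eq_mul, mul_left_comm _ l] at h1
    rw [← Finset.mul_sum, sum_X_mul_grad hg, mul_left_comm] at h1
    exact (mul_left_cancel₀ (Nat.cast_ne_zero.mpr hd) h1).symm
  have key : ∀ j, g * pderiv j f = f * pderiv j g := by
    intro j
    apply IsFractionRing.injective (MvPolynomial (Fin n) ℂ) (FractionRing (MvPolynomial (Fin n) ℂ))
    have := congrFun h j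
    simp only [grad, Pi.smul_apply, smul_eq_mul] at this
    rw [map_mul, map_mul, this, hl]
    ring
  obtain ⟨a, b, c, hab, rfl, rfl⟩ := UniqueFactorizationMonoid.exists_reduced_factors' f g hg0
  have hc0 : c ≠ 0 := left_ne_zero_of_mul hg0
  have hb0 : b ≠ 0 := right_ne_zero_of_mul hg0
  have ha0 : a ≠ 0 := right_ne_zero_of_mul hf0
  have key' : ∀ j, b * pderiv j a = a * pderiv j b := by
    intro j
    apply mul_left_cancel₀ (mul_ne_zero hc0 hc0)
    have := key j
    simp only [pderiv_mul] at this
    linear_combination this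
  obtain ⟨c1, a1, e1, hc1, ha1⟩ := exists_isHomogeneous_of_mul hf hf0
  obtain ⟨c2, b1, e2, hc2, hb1⟩ := exists_isHomogeneous_of_mul hg hg0
  have ec := hc1.inj_right hc2 hc0
  obtain rfl : a1 = b1 := by omega
  -- With a and b coprime, b divides each of its own partial derivatives, which have smaller degree;
  -- so b is constant, and so is a.
  have ha10 : a1 = 0 := by
    by_contra hne
    apply hb0
    refine eq_zero_of_forall_pderiv_eq_zero hb1 hne fun j => ?_
    exact eq_zero_of_dvd_of_isHomogeneous hb1 hb0 hb1.pderiv (by omega)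
      (hab.symm.dvd_of_dvd_mul_left ⟨_, (key' j).symm⟩)
  subst ha10
  obtain ⟨α, rfl⟩ := exists_eq_C_of_isHomogeneous_zero ha1
  obtain ⟨β, rfl⟩ := exists_eq_C_of_isHomogeneous_zero hb1
  have hβ : β ≠ 0 := by rintro rfl; simp at hb0
  refine ⟨α / β, ?_⟩
  rw [mul_left_comm, ← C_mul, div_mul_cancel₀ _ hβ]

/-! ### Directional derivatives -/

/-- The derivation `∑ vᵢ ∂ᵢ`. -/
def dirDeriv (v : PolyMap n) : Derivation ℂ (MvPolynomial (Fin n) ℂ) (MvPolynomial (Fin n) ℂ) :=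
  ∑ i, v i • pderiv i

theorem dirDeriv_apply (v : PolyMap n) (f : MvPolynomial (Fin n) ℂ) :
    dirDeriv v f = ∑ i, v i * pderiv i f := by
  rw [dirDeriv, ← Derivation.coeFnAddMonoidHom_apply, map_sum, Finset.sum_apply]
  rfl

theorem dirDeriv_X (v : PolyMap n) (i : Fin n) : dirDeriv v (X i) = v i := by
  classical
  rw [dirDeriv_apply, Finset.sum_eq_single i]
  · simp
  · intro j _ hj
    rw [pderiv_X_of_ne hj.symm, mul_zero]
  · simp

theorem dirDeriv_C (v : PolyMap n) (c : ℂ) : dirDeriv v (C c) = 0 :=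
  derivation_C _ c

/-- Derivatives in constant directions commute. -/
theorem dirDeriv_C_comm (u w : Fin n → ℂ) (f : MvPolynomial (Fin n) ℂ) :
    dirDeriv (fun i => C (u i)) (dirDeriv (fun i => C (w i)) f) =
      dirDeriv (fun i => C (w i)) (dirDeriv (fun i => C (u i)) f) := by
  have : ⁅dirDeriv (fun i => C (u i)), dirDeriv (fun i => C (w i))⁆ = 0 := by
    refine derivation_ext fun i => ?_
    rw [Derivation.commutator_apply, dirDeriv_X, dirDeriv_X, dirDeriv_C, dirDeriv_C]
    simp
  have h := congrArg (fun D => D f) this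
  simpa [Derivation.commutator_apply, sub_eq_zero] using h

theorem isHomogeneous_dirDeriv_C (u : Fin n → ℂ) {f : MvPolynomial (Fin n) ℂ} {d : ℕ}
    (hf : f.IsHomogeneous d) : (dirDeriv (fun i => C (u i)) f).IsHomogeneous (d - 1) := by
  rw [dirDeriv_apply]
  exact IsHomogeneous.sum _ _ _ fun i _ => hf.pderiv.C_mul _

theorem eval_dirDeriv_C_self (u : Fin n → ℂ) {f : MvPolynomial (Fin n) ℂ} {d : ℕ}
    (hf : f.IsHomogeneous d) : eval u (dirDeriv (fun i => C (u i)) f) = d * eval u f := by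
  have := congrArg (eval u) hf.sum_X_mul_pderiv
  rw [dirDeriv_apply]
  simpa using this

theorem eval_dirDeriv (v : PolyMap n) (f : MvPolynomial (Fin n) ℂ) (y : Fin n → ℂ) :
    eval y (dirDeriv v f) = eval y (dirDeriv (fun i => C (eval y (v i))) f) := by
  simp [dirDeriv_apply]

theorem eval_smul_of_isHomogeneous {f : MvPolynomial (Fin n) ℂ} {d : ℕ} (hf : f.IsHomogeneous d)
    (c : ℂ) (y : Fin n → ℂ) : eval (c • y) f = c ^ d * eval y f := by
  rw [eval_eq, eval_eq, Finset.mul_sum]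
  refine Finset.sum_congr rfl fun s hs => ?_
  simp only [Pi.smul_apply, smul_eq_mul, mul_pow, Finset.prod_mul_distrib,
    Finset.prod_pow_eq_pow_sum]
  rw [hf.degree_eq_sum_deg_support hs]
  ring

/-! ### Invariance along the flow x + TH -/

/-- The homomorphism `f(x) ↦ f(x + T H)`. -/
def shiftHom (H : PolyMap n) : MvPolynomial (Fin n) ℂ →ₐ[ℂ] Polynomial (MvPolynomial (Fin n) ℂ) :=
  aeval fun i => Polynomial.C (X i) + Polynomial.C (H i) * Polynomial.X

theorem eval_shiftHom (H : PolyMap n) (f g : MvPolynomial (Fin n) ℂ) :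
    (shiftHom H f).eval g = bind₁ (fun i => X i + H i * g) f := by
  have : (Polynomial.evalRingHom g).comp (shiftHom H).toRingHom =
      (bind₁ fun i => X i + H i * g).toRingHom := by
    refine MvPolynomial.ringHom_ext (fun c => ?_) fun i => ?_
    · change Polynomial.eval g (shiftHom H (C c)) = bind₁ (fun i => X i + H i * g) (C c)
      rw [shiftHom, aeval_C, bind₁_C_right]
      exact Polynomial.eval_C
    · change Polynomial.eval g (shiftHom H (X i)) = bind₁ (fun i => X i + H i * g) (X i)
      rw [shiftHom, aeval_X, bind₁_X_right]
      simp
  exact congrArg (fun φ => φ f) this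

theorem eval_zero_shiftHom (H : PolyMap n) (f : MvPolynomial (Fin n) ℂ) :
    (shiftHom H f).eval 0 = f := by
  rw [eval_shiftHom]
  simp only [mul_zero, add_zero]
  exact congrArg (fun φ => φ f) bind₁_X_left

theorem shiftHom_injective (H : PolyMap n) : Function.Injective (shiftHom H) := by
  intro f g h
  rw [← eval_zero_shiftHom H f, h, eval_zero_shiftHom]

/-- Factors of nonzero polynomials invariant under `x ↦ x + T H` are invariant. -/
theorem shiftHom_eq_C_of_mul {H : PolyMap n} {f g : MvPolynomial (Fin n) ℂ}
    (h : shiftHom H (f * g) = Polynomial.C (f * g)) (h0 : f * g ≠ 0) :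
    shiftHom H f = Polynomial.C f := by
  have hf : shiftHom H f ≠ 0 :=
    (map_ne_zero_iff _ (shiftHom_injective H)).mpr (left_ne_zero_of_mul h0)
  have hg : shiftHom H g ≠ 0 :=
    (map_ne_zero_iff _ (shiftHom_injective H)).mpr (right_ne_zero_of_mul h0)
  -- Degrees in T add and the product has degree zero, so each factor has degree zero.
  have e := congrArg Polynomial.natDegree h
  rw [map_mul, Polynomial.natDegree_mul hf hg, Polynomial.natDegree_C] at e
  obtain ⟨c, hc⟩ := Polynomial.natDegree_eq_zero.mp (show (shiftHom H f).natDegree = 0 by omega)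
  have := eval_zero_shiftHom H f
  rw [← hc, Polynomial.eval_C] at this
  rw [← hc, this]

theorem eval_zero_derivative_shiftHom (H : PolyMap n) (f : MvPolynomial (Fin n) ℂ) :
    (Polynomial.derivative (shiftHom H f)).eval 0 = dirDeriv H f := by
  induction f using MvPolynomial.induction_on with
  | C c =>
    rw [dirDeriv_C, shiftHom, aeval_C]
    change (Polynomial.derivative (Polynomial.C _)).eval 0 = 0
    simp
  | add p q hp hq => simp [hp, hq]
  | mul_X p i hp =>
    rw [map_mul, Polynomial.derivative_mul, Polynomial.eval_add, Polynomial.eval_mul,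
      Polynomial.eval_mul, hp, eval_zero_shiftHom, eval_zero_shiftHom, Derivation.leibniz,
      dirDeriv_X]
    have : shiftHom H (X i) = Polynomial.C (X i) + Polynomial.C (H i) * Polynomial.X := by
      rw [shiftHom, aeval_X]
    rw [this]
    simp
    ring

theorem dirDeriv_eq_zero_of_shiftHom {H : PolyMap n} {f : MvPolynomial (Fin n) ℂ}
    (h : shiftHom H f = Polynomial.C f) : dirDeriv H f = 0 := by
  rw [← eval_zero_derivative_shiftHom, h]
  simp

theorem idMap_apply (i : Fin n) : idMap n i = X i := rfl

theorem eval_bind₁ {σ τ : Type*} (g : σ → MvPolynomial τ ℂ) (f : MvPolynomial σ ℂ) (y : τ → ℂ) :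
    eval y (bind₁ g f) = eval (fun i => eval y (g i)) f :=
  eval₂Hom_bind₁ _ y g f

theorem IsQuasiTranslation.subst_eq {H : PolyMap n} (hqt : IsQuasiTranslation H) (i : Fin n) :
    subst (idMap n + H) (H i) = H i := by
  have := congrFun hqt.1 i
  simp only [comp, subst, Pi.sub_apply, idMap_apply, map_sub, bind₁_X_right, Pi.add_apply] at this
  have h2 : H i - bind₁ (idMap n + H) (H i) = 0 := by
    linear_combination this
  exact (sub_eq_zero.mp h2).symm

/-- Iterating H(x + H) = H gives H(x + mH) = H for every natural m, and infinitely many values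
determine a polynomial in T. -/
theorem IsQuasiTranslation.shiftHom_eq {H : PolyMap n} (hqt : IsQuasiTranslation H) (i : Fin n) :
    shiftHom H (H i) = Polynomial.C (H i) := by
  have key : ∀ m : ℕ, ∀ j, bind₁ (fun i => X i + H i * (m : MvPolynomial (Fin n) ℂ)) (H j) =
      H j := by
    intro m
    induction m with
    | zero =>
      intro j
      simp only [Nat.cast_zero, mul_zero, add_zero]
      exact congrArg (fun φ => φ (H j)) bind₁_X_left
    | succ m ih =>
      intro j
      have h := congrArg (subst (idMap n + H)) (ih j)
      rw [hqt.subst_eq, subst, bind₁_bind₁] at h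
      rw [← h]
      congr 2
      ext1 k
      have hk := hqt.subst_eq k
      rw [subst] at hk
      rw [map_add, map_mul, hk, map_natCast, bind₁_X_right, Pi.add_apply, idMap]
      push_cast
      ring
  refine Polynomial.eq_of_infinite_eval_eq _ _ ?_
  refine Set.Infinite.mono (s := Set.range fun m : ℕ => (m : MvPolynomial (Fin n) ℂ)) ?_
    (Set.infinite_range_of_injective Nat.cast_injective)
  rintro _ ⟨m, rfl⟩
  rw [Set.mem_ofPred_eq, eval_shiftHom, key, Polynomial.eval_C]

theorem IsQuasiTranslation.eval_add_smul {H : PolyMap n} (hqt : IsQuasiTranslation H) (i : Fin n)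
    (a : Fin n → ℂ) (t : ℂ) : eval (a + t • fun j => eval a (H j)) (H i) = eval a (H i) := by
  have h := congrArg (Polynomial.eval (C t)) (hqt.shiftHom_eq i)
  rw [eval_shiftHom, Polynomial.eval_C] at h
  have h2 := congrArg (eval a) h
  rw [← h2, eval_bind₁]
  congr 2
  ext j
  simp [mul_comm]

/-- A homogeneous quasi-translation of positive degree satisfies `H(H(a)) = 0`. -/
theorem IsQuasiTranslation.eval_eval_eq_zero {H : PolyMap n} (hqt : IsQuasiTranslation H) {d : ℕ}
    (hd : d ≠ 0) (hH : ∀ i, (H i).IsHomogeneous d) (a : Fin n → ℂ) (i : Fin n) :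
    eval (fun j => eval a (H j)) (H i) = 0 := by
  set P : Polynomial ℂ := aeval (fun j => Polynomial.C (a j) * Polynomial.X +
    Polynomial.C (eval a (H j))) (H i) with hP
  have hev : ∀ s : ℂ, P.eval s = eval (s • a + fun j => eval a (H j)) (H i) := by
    intro s
    have : (Polynomial.aeval s : Polynomial ℂ →ₐ[ℂ] ℂ).comp
        (aeval (fun j => Polynomial.C (a j) * Polynomial.X + Polynomial.C (eval a (H j)))) =
        aeval (s • a + fun j => eval a (H j)) := by
      ext j
      rw [AlgHom.comp_apply, aeval_X, aeval_X]
      simp only [map_add, map_mul, Polynomial.aeval_X, Polynomial.aeval_C, Pi.add_apply,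
        Pi.smul_apply, smul_eq_mul, Algebra.algebraMap_self, RingHom.id_apply]
      rw [mul_comm]
    have h2 := congrArg (fun φ => φ (H i)) this
    rw [hP, ← Polynomial.coe_aeval_eq_eval]
    exact h2
  -- For s ≠ 0, H(sa + H(a)) = s^d H(a + s⁻¹H(a)) = s^d H(a). This is a polynomial identity in s, so
  -- s = 0 may be substituted.
  have hPX : P = Polynomial.C (eval a (H i)) * Polynomial.X ^ d := by
    refine Polynomial.eq_of_infinite_eval_eq _ _ ?_
    refine Set.Infinite.mono (s := {0}ᶜ) ?_ (Set.finite_singleton (0 : ℂ)).infinite_compl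
    intro s hs
    have hs : s ≠ 0 := hs
    rw [Set.mem_ofPred_eq, hev]
    have : s • a + (fun j => eval a (H j)) = s • (a + s⁻¹ • fun j => eval a (H j)) := by
      rw [smul_add, smul_smul, mul_inv_cancel₀ hs, one_smul]
    rw [this, eval_smul_of_isHomogeneous (hH i), hqt.eval_add_smul, Polynomial.eval_mul,
      Polynomial.eval_C, Polynomial.eval_pow, Polynomial.eval_X, mul_comm]
  have h0 := hev 0
  rw [hPX] at h0
  simpa [hd] using h0.symm

/-! ### Linear invariants and Jacobian rank at most one -/

/-- Linear forms vanishing on a subspace that contains the image of `H` give invariants. -/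
theorem hasIndependentLinearInvariants_of_finrank {H : PolyMap n}
    (U : Submodule ℂ (Fin n → ℂ)) (hU : ∀ y, (fun i => eval y (H i)) ∈ U) {k : ℕ}
    (hk : Module.finrank ℂ U + k ≤ n) : HasIndependentLinearInvariants H k := by
  have hfr := Subspace.finrank_add_finrank_dualAnnihilator_eq U
  rw [Module.finrank_fin_fun] at hfr
  obtain ⟨φ, hφ⟩ := exists_linearIndependent_of_le_finrank (R := ℂ) (M := U.dualAnnihilator)
    (n := k) (by omega)
  let L : Module.Dual ℂ (Fin n → ℂ) →ₗ[ℂ] MvPolynomial (Fin n) ℂ :=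
    { toFun := fun ψ => ∑ i, C (ψ (Pi.single i 1)) * X i
      map_add' := fun ψ χ => by simp [add_mul, Finset.sum_add_distrib]
      map_smul' := fun c ψ => by
        simp [Finset.smul_sum, MvPolynomial.smul_eq_C_mul, mul_assoc] }
  have hL : ∀ ψ y, eval y (L ψ) = ψ y := by
    intro ψ y
    conv_rhs => rw [pi_eq_sum_univ' y]
    simp [L, mul_comm]
  have hLinj : LinearMap.ker (L ∘ₗ U.dualAnnihilator.subtype) = ⊥ := by
    rw [LinearMap.ker_eq_bot']
    intro ψ hψ
    ext1
    refine LinearMap.ext fun y => ?_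
    rw [← hL]
    change eval y ((L ∘ₗ U.dualAnnihilator.subtype) ψ) = _
    simp [hψ]
  refine ⟨_, hφ.map' _ hLinj, fun j => ⟨?_, ?_⟩⟩
  · change (∑ i, C ((φ j : Module.Dual ℂ (Fin n → ℂ)) (Pi.single i 1)) * X i).IsHomogeneous 1
    exact IsHomogeneous.sum _ _ _ fun i _ => (isHomogeneous_X ℂ i).C_mul _
  · change bind₁ (idMap n + H) (L (φ j)) = L (φ j)
    refine MvPolynomial.funext fun y => ?_
    have : eval y (bind₁ (idMap n + H) (L (φ j))) =
        eval (y + fun i => eval y (H i)) (L (φ j)) := by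
      rw [eval_bind₁]
      congr 2
      ext i
      simp [idMap_apply]
    rw [this, hL, hL, map_add, (Submodule.mem_dualAnnihilator _).mp (φ j).2 _ (hU y), add_zero]

theorem exists_ne_zero_of_one_le_degree {H : PolyMap n} (hdeg : 1 ≤ degree H) {d : ℕ}
    (hH : ∀ i, (H i).IsHomogeneous d) : d ≠ 0 ∧ ∃ i, H i ≠ 0 := by
  obtain ⟨i, -, hi⟩ := (Finset.lt_sup_iff (a := 0)).mp (show 0 < degree H from hdeg)
  refine ⟨?_, i, ?_⟩
  · rintro rfl
    exact hi.ne' ((totalDegree_zero_iff_isHomogeneous _).mpr (hH i))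
  · intro h
    simp [h] at hi

theorem grad_ne_zero {f : MvPolynomial (Fin n) ℂ} {d : ℕ} (hd : d ≠ 0) (hf : f.IsHomogeneous d)
    (hf0 : f ≠ 0) : grad f ≠ 0 := by
  intro h
  have := sum_X_mul_grad hf
  simp only [h, Pi.zero_apply, mul_zero, Finset.sum_const_zero] at this
  rcases mul_eq_zero.mp this.symm with h1 | h1
  · exact hd (Nat.cast_eq_zero.mp h1)
  · exact hf0 ((map_eq_zero_iff _ (IsFractionRing.injective (MvPolynomial (Fin n) ℂ)
      (FractionRing (MvPolynomial (Fin n) ℂ)))).mp h1)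

/-- A homogeneous map of positive degree whose Jacobian has rank at most one is a polynomial
multiple of a constant vector. -/
theorem exists_eq_C_mul_of_rankJacobian_le_one {H : PolyMap n} {d : ℕ} (hd : d ≠ 0)
    (hH : ∀ i, (H i).IsHomogeneous d) (hr : rankJacobian H ≤ 1) {i₀ : Fin n} (h₀ : H i₀ ≠ 0)
    (i : Fin n) : ∃ c, H i = C c * H i₀ := by
  rw [rankJacobian_eq_finrank, finrank_le_one_iff] at hr
  obtain ⟨v, hv⟩ := hr
  have hv' : ∀ j, ∃ c : FractionRing (MvPolynomial (Fin n) ℂ),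
      c • (v : Fin n → FractionRing (MvPolynomial (Fin n) ℂ)) = grad (H j) := by
    intro j
    obtain ⟨c, hc⟩ := hv ⟨grad (H j), Submodule.subset_span ⟨j, rfl⟩⟩
    exact ⟨c, congrArg Subtype.val hc⟩
  obtain ⟨a, ha⟩ := hv' i₀
  obtain ⟨b, hb⟩ := hv' i
  have ha0 : a ≠ 0 := by
    rintro rfl
    rw [zero_smul] at ha
    exact grad_ne_zero hd (hH i₀) h₀ ha.symm
  refine exists_eq_C_mul_of_grad_eq_smul hd (hH i) (hH i₀) h₀ (l := b / a) ?_
  rw [← ha, ← hb, smul_smul, div_mul_cancel₀ _ ha0]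

theorem image_eq_line_of_rankJacobian_le_one {H : PolyMap n} {d : ℕ} (hd : d ≠ 0)
    (hH : ∀ i, (H i).IsHomogeneous d) (hr : rankJacobian H ≤ 1) {i₀ : Fin n} (h₀ : H i₀ ≠ 0) :
    (∃ L : Submodule ℂ (Fin n → ℂ), Module.finrank ℂ L = 1 ∧
      image H = (L : Set (Fin n → ℂ))) ∧ HasIndependentLinearInvariants H (n - 1) := by
  choose c hc using exists_eq_C_mul_of_rankJacobian_le_one hd hH hr h₀
  have hev : ∀ y, (fun i => eval y (H i)) = eval y (H i₀) • c := by
    intro y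
    ext i
    conv_lhs => rw [hc i]
    simp [mul_comm]
  have hc0 : c ≠ 0 := by
    rintro rfl
    apply h₀
    rw [hc i₀]
    simp
  have hn : n ≠ 0 := by
    rintro rfl
    exact i₀.elim0
  have hfr : Module.finrank ℂ (Submodule.span ℂ {c}) = 1 := finrank_span_singleton hc0
  refine ⟨⟨Submodule.span ℂ {c}, hfr, ?_⟩, hasIndependentLinearInvariants_of_finrank
    (Submodule.span ℂ {c}) (fun y => ?_) (by omega)⟩
  · ext z
    rw [SetLike.mem_coe, Submodule.mem_span_singleton]
    constructor
    · rintro ⟨y, rfl⟩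
      exact ⟨_, (hev y).symm⟩
    · rintro ⟨a, rfl⟩
      obtain ⟨y, hy⟩ : ∃ y, eval y (H i₀) ≠ 0 := by
        by_contra! hcon
        exact h₀ (MvPolynomial.funext fun y => by rw [hcon, map_zero])
      -- Scaling y by t multiplies the value by t^d, so a d-th root reaches every point of the line.
      obtain ⟨t, ht⟩ := IsAlgClosed.exists_pow_nat_eq (a / eval y (H i₀)) (Nat.pos_of_ne_zero hd)
      refine ⟨t • y, ?_⟩
      change (fun i => eval (t • y) (H i)) = _
      rw [hev, eval_smul_of_isHomogeneous (hH i₀), ht, div_mul_cancel₀ _ hy]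
  · rw [hev]
    exact Submodule.smul_mem _ _ (Submodule.mem_span_singleton_self c)

/-! ### Rank, dimension of the zero set, and codimension two -/

theorem two_le_rankJacobian_of_gcdEqOne {H : PolyMap n} {d : ℕ} (hd : d ≠ 0)
    (hH : ∀ i, (H i).IsHomogeneous d) {i₀ : Fin n} (h₀ : H i₀ ≠ 0) (hgcd : GcdEqOne H) :
    2 ≤ rankJacobian H := by
  by_contra! hr
  -- In rank at most one `H i₀` divides every component, so it would be a unit of positive degree.
  have hu := hgcd (H i₀) fun i => by
    obtain ⟨c, hc⟩ := exists_eq_C_mul_of_rankJacobian_le_one hd hH (Nat.lt_succ_iff.mp hr) h₀ i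
    exact ⟨C c, by rw [hc, mul_comm]⟩
  have h1 := totalDegree_le_of_dvd_of_isDomain hu.dvd (one_ne_zero (α := MvPolynomial (Fin n) ℂ))
  rw [(hH i₀).totalDegree h₀, totalDegree_one] at h1
  omega

/-- Chains of primes lift by lying over and going up. -/
theorem ringKrullDim_le_of_isIntegral {R S : Type*} [CommRing R] [CommRing S] (f : R →+* S)
    (hinj : Function.Injective f) (hint : f.IsIntegral) : ringKrullDim R ≤ ringKrullDim S := by
  algebraize [f]
  have : FaithfulSMul R S := (faithfulSMul_iff_algebraMap_injective R S).mpr hinj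
  refine iSup_le fun l => ?_
  obtain ⟨⟨Q, hQ, hQl⟩⟩ := Ideal.nonempty_primesOver (S := S) (RelSeries.head l).asIdeal
  obtain ⟨L, hL, -⟩ := Ideal.exists_ltSeries_of_hasGoingUp l Q
  rw [← hL]
  exact Order.LTSeries.length_le_krullDim L

/-- The rank of the Jacobian is at most the dimension of the ring of polynomial expressions
in the components. -/
theorem rankJacobian_le_ringKrullDim (H : PolyMap n) :
    (rankJacobian H : WithBot ℕ∞) ≤
      ringKrullDim (MvPolynomial (Fin n) ℂ ⧸ RingHom.ker (bind₁ H)) := by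
  -- Noether normalization: the quotient is integral over a polynomial ring in s variables. The H_i
  -- are then integral over the image of that ring under `ψ`, so s gradients span all of theirs.
  obtain ⟨s, -, g, hginj, hgint⟩ := exists_integral_inj_algHom_of_quotient
    (RingHom.ker (bind₁ H)) (RingHom.ker_ne_top _)
  have hs : (s : WithBot ℕ∞) ≤ ringKrullDim (MvPolynomial (Fin n) ℂ ⧸ RingHom.ker (bind₁ H)) := by
    refine le_trans (le_of_eq ?_) (ringKrullDim_le_of_isIntegral g.toRingHom hginj hgint)
    simp
  refine le_trans ?_ hs
  norm_cast
  let ψ := (Ideal.kerLiftAlg (bind₁ H)).comp g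
  set W := Submodule.span (FractionRing (MvPolynomial (Fin n) ℂ))
    (Set.range fun j : Fin s => grad (ψ (X j))) with hW
  have hA : ψ.range ≤ gradSubalgebra W := by
    rw [← Algebra.map_top, ← MvPolynomial.adjoin_range_X, AlgHom.map_adjoin, Algebra.adjoin_le_iff]
    rintro _ ⟨_, ⟨j, rfl⟩, rfl⟩
    exact Submodule.subset_span ⟨j, rfl⟩
  have hmem : ∀ i, grad (H i) ∈ W := by
    intro i
    refine grad_mem_of_isAlgebraic hA (IsIntegral.isAlgebraic ?_)
    obtain ⟨P, hP, hPe⟩ := hgint (Ideal.Quotient.mk _ (X i))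
    refine ⟨P.map ψ.rangeRestrict.toRingHom, hP.map _, ?_⟩
    have h2 := congrArg (Ideal.kerLiftAlg (bind₁ H)) hPe
    rw [map_zero] at h2
    rw [← h2, Polynomial.eval₂_map]
    refine Eq.trans ?_ (Polynomial.hom_eval₂ P g.toRingHom
      (Ideal.kerLiftAlg (bind₁ H)).toRingHom _).symm
    have h3 : H i = (Ideal.kerLiftAlg (bind₁ H)).toRingHom
        (Ideal.Quotient.mk _ (X i)) := by
      exact (bind₁_X_right H i).symm
    rw [← h3]
    rfl
  rw [rankJacobian_eq_finrank]
  refine le_trans (Submodule.finrank_mono (Submodule.span_le.mpr ?_ : _ ≤ W)) ?_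
  · rintro _ ⟨i, rfl⟩
    exact hmem i
  · have := finrank_range_le_card (R := FractionRing (MvPolynomial (Fin n) ℂ))
      (fun j : Fin s => grad (ψ (X j)))
    rw [Fintype.card_fin] at this
    exact this

/-- By H(H(a)) = 0 the image of H lies in V(H), so every polynomial vanishing on V(H) is a relation
among the H_i. -/
theorem rankJacobian_le_dim_zeroSet {H : PolyMap n} (hqt : IsQuasiTranslation H) {d : ℕ}
    (hd : d ≠ 0) (hH : ∀ i, (H i).IsHomogeneous d) :
    (rankJacobian H : WithBot ℕ∞) ≤ dim (zeroSet H) := by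
  refine (rankJacobian_le_ringKrullDim H).trans ?_
  have hle : vanishingIdeal ℂ (zeroSet H) ≤ RingHom.ker (bind₁ H) := by
    intro f hf
    rw [mem_vanishingIdeal_iff] at hf
    rw [RingHom.mem_ker]
    refine MvPolynomial.funext fun a => ?_
    rw [map_zero, eval_bind₁, ← coe_aeval_eq_eval]
    exact hf _ fun i => hqt.eval_eval_eq_zero hd hH a i
  exact ringKrullDim_le_of_surjective (Ideal.Quotient.factor hle)
    (Ideal.Quotient.factor_surjective hle)

/-- The zero set of polynomials without common divisor has codimension at least two. -/
theorem dim_zeroSet_add_two_le {H : PolyMap n} {i₀ : Fin n} (h₀ : H i₀ ≠ 0)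
    (hgcd : GcdEqOne H) : dim (zeroSet H) + 2 ≤ (n : WithBot ℕ∞) := by
  have key : ∀ l : LTSeries
      (PrimeSpectrum (MvPolynomial (Fin n) ℂ ⧸ vanishingIdeal ℂ (zeroSet H))),
      l.length + 2 ≤ n := by
    intro l
    have hsm : StrictMono (PrimeSpectrum.comap
        (Ideal.Quotient.mk (vanishingIdeal ℂ (zeroSet H)))) := by
      refine Monotone.strictMono_of_injective (fun p q h => Ideal.comap_mono h) ?_
      exact PrimeSpectrum.comap_injective_of_surjective _ Ideal.Quotient.mk_surjective
    set L := l.map _ hsm with hL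
    have hmem : ∀ i, H i ∈ L.head.asIdeal := by
      intro i
      have : H i ∈ vanishingIdeal ℂ (zeroSet H) := by
        rw [mem_vanishingIdeal_iff]
        intro x hx
        have := hx i
        rwa [← coe_aeval_eq_eval] at this
      change Ideal.Quotient.mk _ (H i) ∈ (l.head).asIdeal
      rw [Ideal.Quotient.eq_zero_iff_mem.mpr this]
      exact Ideal.zero_mem _
    -- The smallest prime of the chain contains a prime element q. Since q does not divide all H_i,
    -- both inclusions 0 ⊂ (q) ⊂ `L.head` are strict, and the chain gains two steps.
    obtain ⟨q, hqm, hq⟩ := Ideal.IsPrime.exists_mem_prime_of_ne_bot L.head.2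
      (fun h => h₀ (by simpa [h] using hmem i₀))
    have hqp : (Ideal.span {q}).IsPrime := (Ideal.span_singleton_prime hq.ne_zero).mpr hq
    let Q : PrimeSpectrum (MvPolynomial (Fin n) ℂ) := ⟨Ideal.span {q}, hqp⟩
    have hQ : Q < L.head := by
      refine lt_of_le_of_ne ?_ ?_
      · change Ideal.span {q} ≤ _
        rwa [Ideal.span_singleton_le_iff_mem]
      · intro h
        refine hq.not_isUnit (hgcd q fun i => ?_)
        have := hmem i
        rw [← h] at this
        exact Ideal.mem_span_singleton.mp this
    let Z : PrimeSpectrum (MvPolynomial (Fin n) ℂ) := ⟨⊥, Ideal.isPrime_bot⟩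
    have hZ : Z < Q := by
      change (⊥ : Ideal _) < Ideal.span {q}
      rw [bot_lt_iff_ne_bot, Ne, Ideal.span_singleton_eq_bot]
      exact hq.ne_zero
    have hlen := Order.LTSeries.length_le_krullDim ((L.cons Q hQ).cons Z hZ)
    have hdim : Order.krullDim (PrimeSpectrum (MvPolynomial (Fin n) ℂ)) = n := by
      change ringKrullDim _ = _
      simp
    rw [hdim] at hlen
    have : ((L.cons Q hQ).cons Z hZ).length = l.length + 2 :=
      (RelSeries.cons_length _ _ _).trans (congrArg (· + 1) (RelSeries.cons_length _ _ _))
    rw [this] at hlen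
    exact_mod_cast hlen
  -- Without primes the dimension is `⊥`; with one, `key` gives 2 ≤ n, so that `n - 2` is not
  -- truncated.
  rcases isEmpty_or_nonempty
    (PrimeSpectrum (MvPolynomial (Fin n) ℂ ⧸ vanishingIdeal ℂ (zeroSet H))) with he | ⟨⟨x⟩⟩
  · rw [dim, ringKrullDim, Order.krullDim_eq_bot]
    simp
  · have h2 : 2 ≤ n := le_trans (by omega) (key (RelSeries.singleton _ x))
    have hle : dim (zeroSet H) ≤ ((n - 2 : ℕ) : WithBot ℕ∞) := by
      refine iSup_le fun l => ?_
      have := key l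
      have h3 : l.length ≤ n - 2 := by omega
      exact_mod_cast h3
    calc dim (zeroSet H) + 2 ≤ ((n - 2 : ℕ) : WithBot ℕ∞) + 2 := by gcongr
      _ = ((n - 2 + 2 : ℕ) : WithBot ℕ∞) := by push_cast; rfl
      _ = n := by rw [Nat.sub_add_cancel h2]

/-! ### Binary forms -/

/-- The binary form `∑ Nₖ pᵏ qᴹ⁻ᵏ` obtained by homogenizing `N` in degree `M`. -/
def binaryForm {R : Type*} [CommRing R] [Algebra ℂ R] (N : Polynomial ℂ) (M : ℕ) (p q : R) : R :=
  ∑ k ∈ Finset.range (M + 1), algebraMap ℂ R (N.coeff k) * (p ^ k * q ^ (M - k))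

theorem map_binaryForm {R S : Type*} [CommRing R] [Algebra ℂ R] [CommRing S] [Algebra ℂ S]
    (φ : R →ₐ[ℂ] S) (N : Polynomial ℂ) (M : ℕ) (p q : R) :
    φ (binaryForm N M p q) = binaryForm N M (φ p) (φ q) := by
  simp [binaryForm]

theorem binaryForm_mul {R : Type*} [CommRing R] [Algebra ℂ R] (N : Polynomial ℂ) (M : ℕ)
    (g p q : R) : binaryForm N M (g * p) (g * q) = g ^ M * binaryForm N M p q := by
  rw [binaryForm, binaryForm, Finset.mul_sum]
  refine Finset.sum_congr rfl fun k hk => ?_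
  have : M = k + (M - k) := by
    simp only [Finset.mem_range] at hk
    omega
  rw [mul_pow, mul_pow]
  conv_rhs => rw [this, pow_add, add_tsub_cancel_left]
  ring

theorem binaryForm_eq_aeval {F : Type*} [Field F] [Algebra ℂ F] {N : Polynomial ℂ} {M : ℕ}
    (hN : N.natDegree ≤ M) (p : F) {q : F} (hq : q ≠ 0) :
    binaryForm N M p q = q ^ M * Polynomial.aeval (p / q) N := by
  rw [binaryForm, Polynomial.aeval_eq_sum_range' (Nat.lt_succ_of_le hN), Finset.mul_sum]
  refine Finset.sum_congr rfl fun k hk => ?_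
  have : M = (M - k) + k := by
    simp only [Finset.mem_range] at hk
    omega
  rw [Algebra.smul_def, div_pow]
  have hM : q ^ M = q ^ (M - k) * q ^ k := by rw [← pow_add, ← this]
  rw [hM]
  field_simp

theorem isHomogeneous_binaryForm (N : Polynomial ℂ) (M : ℕ) {p q : MvPolynomial (Fin n) ℂ} {m : ℕ}
    (hp : p.IsHomogeneous m) (hq : q.IsHomogeneous m) :
    (binaryForm N M p q).IsHomogeneous (m * M) := by
  refine IsHomogeneous.sum _ _ _ fun k hk => ?_
  have : M = k + (M - k) := by
    simp only [Finset.mem_range] at hk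
    omega
  refine IsHomogeneous.C_mul ?_ _
  have h := (hp.pow k).mul (hq.pow (M - k))
  rwa [← mul_add, ← this] at h

/-! ### Restriction to a line and Lüroth's theorem -/

theorem algebraicIndependent_pair {f g : MvPolynomial (Fin n) ℂ} {d : ℕ} (hd : d ≠ 0)
    (hf : f.IsHomogeneous d) (hg : g.IsHomogeneous d) (hf0 : f ≠ 0) (hfg : ∀ c, g ≠ C c * f) :
    AlgebraicIndependent ℂ (fun o : Option Unit => o.elim g fun _ => f) := by
  rw [AlgebraicIndependent.option_iff]
  refine ⟨?_, ?_⟩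
  · rw [algebraicIndependent_unique_type_iff]
    intro hal
    -- An f algebraic over ℂ would have zero gradient; below, a g algebraic over ℂ[f] would have
    -- gradient proportional to that of f.
    have h1 : IsAlgebraic (gradSubalgebra (⊥ : Submodule (FractionRing (MvPolynomial (Fin n) ℂ))
        (Fin n → FractionRing (MvPolynomial (Fin n) ℂ)))) f :=
      hal.extendScalars (RingHom.injective _)
    have := grad_mem_of_isAlgebraic le_rfl h1
    exact grad_ne_zero hd hf hf0 ((Submodule.mem_bot _).mp this)
  · intro hal
    have hA : Algebra.adjoin ℂ (Set.range fun _ : Unit => f) ≤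
        gradSubalgebra (Submodule.span _ {grad f}) := by
      rw [Algebra.adjoin_le_iff]
      rintro _ ⟨_, rfl⟩
      exact Submodule.mem_span_singleton_self _
    obtain ⟨l, hl⟩ := Submodule.mem_span_singleton.mp (grad_mem_of_isAlgebraic hA hal)
    obtain ⟨c, hc⟩ := exists_eq_C_mul_of_grad_eq_smul hd hg hf hf0 hl.symm
    exact hfg c hc

/-- Otherwise f, g, G would have three independent gradients in a space of dimension at most two. -/
theorem isAlgebraic_of_grad_mem {f g G : MvPolynomial (Fin n) ℂ}
    (hfg : AlgebraicIndependent ℂ (fun o : Option Unit => o.elim g fun _ => f))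
    {W : Submodule (FractionRing (MvPolynomial (Fin n) ℂ))
      (Fin n → FractionRing (MvPolynomial (Fin n) ℂ))}
    (hW : Module.finrank (FractionRing (MvPolynomial (Fin n) ℂ)) W ≤ 2)
    (hf : grad f ∈ W) (hg : grad g ∈ W) (hG : grad G ∈ W) :
    IsAlgebraic (Algebra.adjoin ℂ (Set.range fun o : Option Unit => o.elim g fun _ => f)) G := by
  by_contra hal
  have hli := linearIndependent_grad ((hfg.option_iff_transcendental G).mpr hal)
  let v : Option (Option Unit) → W := fun o => o.elim ⟨grad G, hG⟩ fun o => o.elim ⟨grad g, hg⟩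
    fun _ => ⟨grad f, hf⟩
  have hv : LinearIndependent (FractionRing (MvPolynomial (Fin n) ℂ)) v := by
    refine LinearIndependent.of_comp W.subtype ?_
    convert hli using 1
    funext o
    rcases o with _ | _ | _ <;> rfl
  have := hv.fintype_card_le_finrank
  simp only [Fintype.card_option, Fintype.card_unit] at this
  omega

/-- A nonzero algebraic G divides some nonzero b(f, g). If ρ kills G, it kills b(f, g), against the
independence of the images. -/
theorem eq_zero_of_map_eq_zero {m : ℕ} {f g G : MvPolynomial (Fin n) ℂ}
    (ρ : MvPolynomial (Fin n) ℂ →ₐ[ℂ] MvPolynomial (Fin m) ℂ)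
    (hρ : AlgebraicIndependent ℂ (fun o : Option Unit => o.elim (ρ g) fun _ => ρ f))
    (hG : IsAlgebraic (Algebra.adjoin ℂ (Set.range fun o : Option Unit => o.elim g fun _ => f)) G)
    (h0 : ρ G = 0) : G = 0 := by
  by_contra hG0
  obtain ⟨⟨r, hr⟩, hr0, hdvd⟩ := hG.exists_nonzero_dvd (mem_nonZeroDivisors_of_ne_zero hG0)
  rw [Algebra.adjoin_range_eq_range_aeval] at hr
  obtain ⟨b, rfl⟩ := hr
  have hd2 := map_dvd ρ hdvd
  rw [h0, zero_dvd_iff] at hd2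
  have hcomp : aeval (fun o : Option Unit => o.elim (ρ g) fun _ => ρ f) b = 0 := by
    rw [← hd2]
    change _ = ρ (aeval _ b)
    have h1 : (aeval (fun o : Option Unit => o.elim (ρ g) fun _ => ρ f) :
        MvPolynomial (Option Unit) ℂ →ₐ[ℂ] _) =
        ρ.comp (aeval fun o : Option Unit => o.elim g fun _ => f) := by
      ext1 o
      rcases o with _ | _ <;> simp
    rw [h1]
    rfl
  have hb := (injective_iff_map_eq_zero _).mp hρ b hcomp
  subst hb
  exact hr0 (Subtype.ext (map_zero _))

/-- The restriction of polynomials to the line `a + T b`. -/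
def lineHom (a b : Fin n → ℂ) : MvPolynomial (Fin n) ℂ →ₐ[ℂ] Polynomial ℂ :=
  aeval fun k => Polynomial.C (a k) + Polynomial.C (b k) * Polynomial.X

theorem eval_lineHom (a b : Fin n → ℂ) (f : MvPolynomial (Fin n) ℂ) (t : ℂ) :
    (lineHom a b f).eval t = eval (a + t • b) f := by
  have : (Polynomial.aeval t : Polynomial ℂ →ₐ[ℂ] ℂ).comp (lineHom a b) = aeval (a + t • b) := by
    ext j
    rw [AlgHom.comp_apply, lineHom, aeval_X, aeval_X]
    simp only [map_add, map_mul, Polynomial.aeval_X, Polynomial.aeval_C, Pi.add_apply,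
      Pi.smul_apply, smul_eq_mul, Algebra.algebraMap_self, RingHom.id_apply]
    rw [mul_comm]
  have h2 := congrArg (fun φ => φ f) this
  rw [← Polynomial.coe_aeval_eq_eval]
  exact h2

theorem isHomogeneous_bind₁ {m d e : ℕ} {H : Fin n → MvPolynomial (Fin m) ℂ}
    (hH : ∀ i, (H i).IsHomogeneous d) {Q : MvPolynomial (Fin n) ℂ} (hQ : Q.IsHomogeneous e) :
    (bind₁ H Q).IsHomogeneous (d * e) :=
  hQ.aeval _ hH

/-- A homogeneous relation between the restrictions of the components of `H` to a suitable line
holds for the components themselves if the Jacobian has rank at most two. -/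
theorem bind₁_eq_zero_of_lineHom {H : PolyMap n} {d : ℕ} (hd : d ≠ 0)
    (hH : ∀ i, (H i).IsHomogeneous d) (hr : rankJacobian H ≤ 2) {i₀ j₀ : Fin n}
    {a b : Fin n → ℂ}
    (hab : eval a (H i₀) * eval b (H j₀) ≠ eval a (H j₀) * eval b (H i₀))
    {Q : MvPolynomial (Fin n) ℂ} {m : ℕ} (hQ : Q.IsHomogeneous m)
    (h : lineHom a b (bind₁ H Q) = 0) : bind₁ H Q = 0 := by
  -- The line is homogenized to the plane x₀a + x₁b, where homogeneity is preserved. The inequality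
  -- `hab` keeps the restrictions of `H i₀` and `H j₀` nonproportional, hence algebraically
  -- independent.
  set ρ : MvPolynomial (Fin n) ℂ →ₐ[ℂ] MvPolynomial (Fin 2) ℂ :=
    bind₁ fun k => C (a k) * X 0 + C (b k) * X 1 with hρ
  have hev : ∀ f x, eval x (ρ f) = eval (x 0 • a + x 1 • b) f := by
    intro f x
    rw [hρ, eval_bind₁]
    congr 2
    ext k
    simp [mul_comm]
  have hρhom : ∀ {f : MvPolynomial (Fin n) ℂ} {e : ℕ}, f.IsHomogeneous e →
      (ρ f).IsHomogeneous e := by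
    intro f e hf
    have := isHomogeneous_bind₁ (d := 1) (H := fun k => C (a k) * X 0 + C (b k) * X (1 : Fin 2))
      (fun k => ((isHomogeneous_X ℂ 0).C_mul _).add ((isHomogeneous_X ℂ 1).C_mul _)) hf
    rwa [one_mul] at this
  have hproj : ∀ c, ρ (H j₀) ≠ C c * ρ (H i₀) := by
    intro c hc
    have h1 := congrArg (eval ![1, 0]) hc
    have h2 := congrArg (eval ![0, 1]) hc
    simp only [map_mul, eval_C, hev] at h1 h2
    simp only [Matrix.cons_val_zero, Matrix.cons_val_one, one_smul, zero_smul, add_zero,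
      zero_add] at h1 h2
    apply hab
    rw [h1, h2]
    ring
  have hi0 : ρ (H i₀) ≠ 0 := by
    intro hc
    have h1 := congrArg (eval ![1, 0]) hc
    have h2 := congrArg (eval ![0, 1]) hc
    simp only [map_zero, hev] at h1 h2
    simp only [Matrix.cons_val_zero, Matrix.cons_val_one, one_smul, zero_smul, add_zero,
      zero_add] at h1 h2
    apply hab
    rw [h1, h2]
    ring
  have hHi0 : H i₀ ≠ 0 := by
    intro hc
    exact hi0 (by rw [hc, map_zero])
  have hind := algebraicIndependent_pair hd (hH i₀) (hH j₀) hHi0 fun c hc =>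
    hproj c (by rw [hc, map_mul, hρ, bind₁_C_right])
  have hind2 := algebraicIndependent_pair hd (hρhom (hH i₀)) (hρhom (hH j₀)) hi0 hproj
  rw [rankJacobian_eq_finrank] at hr
  set W := Submodule.span (FractionRing (MvPolynomial (Fin n) ℂ)) (Set.range fun i => grad (H i))
  have hHW : ∀ i, grad (H i) ∈ W := fun i => Submodule.subset_span ⟨i, rfl⟩
  have hGW : grad (bind₁ H Q) ∈ W := by
    have : bind₁ H Q ∈ Algebra.adjoin ℂ (Set.range H) := by
      rw [Algebra.adjoin_range_eq_range_aeval]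
      exact ⟨Q, rfl⟩
    have hle : Algebra.adjoin ℂ (Set.range H) ≤ gradSubalgebra W := by
      rw [Algebra.adjoin_le_iff]
      rintro _ ⟨i, rfl⟩
      exact hHW i
    exact hle this
  have halg := isAlgebraic_of_grad_mem hind hr (hHW i₀) (hHW j₀) hGW
  refine eq_zero_of_map_eq_zero ρ hind2 halg ?_
  -- Off x₀ = 0, homogeneity rescales a point of the plane to one on the line; the factor `X 0`
  -- covers the rest.
  have hX : ρ (bind₁ H Q) * X 0 = 0 := by
    refine MvPolynomial.funext fun x => ?_
    rw [map_mul, eval_X, map_zero]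
    by_cases hx : x 0 = 0
    · rw [hx, mul_zero]
    · have h1 : x 0 • a + x 1 • b = x 0 • (a + (x 1 / x 0) • b) := by
        rw [smul_add, smul_smul, mul_div_cancel₀ _ hx]
      rw [hev, h1, eval_smul_of_isHomogeneous (isHomogeneous_bind₁ hH hQ), ← eval_lineHom, h]
      simp
  exact (mul_eq_zero.mp hX).resolve_right (X_ne_zero _)

/-- The field of quotients of homogeneous expressions of equal degree in the `φᵢ`. -/
def ratioField {L : Type*} [Field L] [Algebra ℂ L] (φ : Fin n → L) : IntermediateField ℂ L where
  carrier := {z | ∃ (m : ℕ) (P Q : MvPolynomial (Fin n) ℂ), P.IsHomogeneous m ∧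
    Q.IsHomogeneous m ∧ aeval φ Q ≠ 0 ∧ z = aeval φ P / aeval φ Q}
  mul_mem' := by
    rintro _ _ ⟨m, P, Q, hP, hQ, h0, rfl⟩ ⟨m', P', Q', hP', hQ', h0', rfl⟩
    refine ⟨m + m', P * P', Q * Q', hP.mul hP', hQ.mul hQ', ?_, ?_⟩
    · rw [map_mul]
      exact mul_ne_zero h0 h0'
    · rw [map_mul, map_mul, div_mul_div_comm]
  add_mem' := by
    rintro _ _ ⟨m, P, Q, hP, hQ, h0, rfl⟩ ⟨m', P', Q', hP', hQ', h0', rfl⟩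
    refine ⟨m + m', P * Q' + Q * P', Q * Q', (hP.mul hQ').add (hQ.mul hP'), hQ.mul hQ', ?_, ?_⟩
    · rw [map_mul]
      exact mul_ne_zero h0 h0'
    · rw [map_mul, map_add, map_mul, map_mul, div_add_div _ _ h0 h0']
  algebraMap_mem' c := ⟨0, C c, 1, isHomogeneous_C _ _, isHomogeneous_one _ _, by simp, by simp⟩
  inv_mem' := by
    rintro _ ⟨m, P, Q, hP, hQ, h0, rfl⟩
    by_cases hP0 : aeval φ P = 0
    · exact ⟨0, 0, 1, isHomogeneous_zero _ _ _, isHomogeneous_one _ _, by simp, by simp [hP0]⟩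
    · exact ⟨m, Q, P, hQ, hP, hP0, by rw [inv_div]⟩

theorem mem_ratioField {L : Type*} [Field L] [Algebra ℂ L] {φ : Fin n → L} {z : L} :
    z ∈ ratioField φ ↔ ∃ (m : ℕ) (P Q : MvPolynomial (Fin n) ℂ), P.IsHomogeneous m ∧
      Q.IsHomogeneous m ∧ aeval φ Q ≠ 0 ∧ z = aeval φ P / aeval φ Q := Iff.rfl

/-- Lüroth's theorem for the ratios of the components of `H`. -/
theorem exists_binaryForm {H : PolyMap n} {d : ℕ} (hd : d ≠ 0)
    (hH : ∀ i, (H i).IsHomogeneous d) (hr : rankJacobian H ≤ 2) {i₀ j₀ : Fin n}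
    {a b : Fin n → ℂ}
    (hab : eval a (H i₀) * eval b (H j₀) ≠ eval a (H j₀) * eval b (H i₀)) :
    ∃ (m : ℕ) (P Q : MvPolynomial (Fin n) ℂ), P.IsHomogeneous m ∧ Q.IsHomogeneous m ∧
      bind₁ H Q ≠ 0 ∧ ∀ i, ∃ (M : ℕ) (N E : Polynomial ℂ),
        H i * binaryForm E M (bind₁ H P) (bind₁ H Q) =
          H i₀ * binaryForm N M (bind₁ H P) (bind₁ H Q) ∧
        binaryForm E M (bind₁ H P) (bind₁ H Q) ≠ 0 := by
  let φ : Fin n → RatFunc ℂ := fun i => algebraMap (Polynomial ℂ) (RatFunc ℂ) (lineHom a b (H i))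
  have hφ : ∀ Q : MvPolynomial (Fin n) ℂ,
      aeval φ Q = algebraMap (Polynomial ℂ) (RatFunc ℂ) (lineHom a b (bind₁ H Q)) := by
    intro Q
    have : aeval φ = ((IsScalarTower.toAlgHom ℂ (Polynomial ℂ) (RatFunc ℂ)).comp
        (lineHom a b)).comp (bind₁ H) := by
      ext i
      simp [φ]
    rw [this]
    rfl
  have hinj : Function.Injective (algebraMap (Polynomial ℂ) (RatFunc ℂ)) :=
    IsFractionRing.injective _ _
  -- Homogeneous relations found on the line lift back to H, so Lüroth's theorem in ℂ(T) suffices.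
  have htransfer : ∀ {Q : MvPolynomial (Fin n) ℂ} {m : ℕ}, Q.IsHomogeneous m → aeval φ Q = 0 →
      bind₁ H Q = 0 := by
    intro Q m hQ h0
    refine bind₁_eq_zero_of_lineHom hd hH hr hab hQ ?_
    rwa [hφ, map_eq_zero_iff _ hinj] at h0
  have hi0 : aeval φ (X i₀ : MvPolynomial (Fin n) ℂ) ≠ 0 := by
    intro h0
    have := htransfer (isHomogeneous_X ℂ i₀) h0
    rw [bind₁_X_right] at this
    apply hab
    simp [this]
  obtain ⟨m, P, Q, hP, hQ, hQ0, hθ⟩ := mem_ratioField.mp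
    (show RatFunc.Luroth.generator (ratioField φ) ∈ ratioField φ by
      have h := IntermediateField.mem_adjoin_simple_self ℂ
        (RatFunc.Luroth.generator (ratioField φ))
      rwa [← RatFunc.Luroth.eq_adjoin_generator (E := ratioField φ)] at h)
  refine ⟨m, P, Q, hP, hQ, ?_, ?_⟩
  · intro h0
    rw [hφ, h0] at hQ0
    simp at hQ0
  intro i
  have hi : aeval φ (X i : MvPolynomial (Fin n) ℂ) / aeval φ (X i₀ : MvPolynomial (Fin n) ℂ) ∈
      ratioField φ := ⟨1, X i, X i₀, isHomogeneous_X _ _, isHomogeneous_X _ _, hi0, rfl⟩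
  rw [RatFunc.Luroth.eq_adjoin_generator (E := ratioField φ),
    IntermediateField.mem_adjoin_simple_iff, hθ] at hi
  obtain ⟨N, E, hNE⟩ : ∃ N E : Polynomial ℂ,
      Polynomial.aeval (aeval φ P / aeval φ Q) E ≠ 0 ∧
      aeval φ (X i : MvPolynomial (Fin n) ℂ) * Polynomial.aeval (aeval φ P / aeval φ Q) E =
        aeval φ (X i₀ : MvPolynomial (Fin n) ℂ) *
          Polynomial.aeval (aeval φ P / aeval φ Q) N := by
    obtain ⟨N, E, h⟩ := hi
    -- A vanishing denominator makes the quotient 0 by convention; then H_i restricts to zero on the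
    -- line, and 0/1 represents it.
    by_cases hE : Polynomial.aeval (aeval φ P / aeval φ Q) E = 0
    · rw [hE, div_zero, div_eq_zero_iff] at h
      exact ⟨0, 1, by simp, by simp [h.resolve_right hi0]⟩
    · refine ⟨N, E, hE, ?_⟩
      rw [div_eq_div_iff hi0 hE] at h
      rw [h, mul_comm]
  -- Numerator and denominator must be homogenized in the same degree.
  set M := max N.natDegree E.natDegree
  have hbN : aeval φ (binaryForm N M P Q) = (aeval φ Q) ^ M *
      Polynomial.aeval (aeval φ P / aeval φ Q) N := by
    rw [map_binaryForm, binaryForm_eq_aeval (le_max_left _ _) _ hQ0]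
  have hbE : aeval φ (binaryForm E M P Q) = (aeval φ Q) ^ M *
      Polynomial.aeval (aeval φ P / aeval φ Q) E := by
    rw [map_binaryForm, binaryForm_eq_aeval (le_max_right _ _) _ hQ0]
  refine ⟨M, N, E, ?_, ?_⟩
  · have hhom : (X i * binaryForm E M P Q - X i₀ * binaryForm N M P Q).IsHomogeneous
        (1 + m * M) :=
      ((isHomogeneous_X _ _).mul (isHomogeneous_binaryForm E M hP hQ)).sub
        ((isHomogeneous_X _ _).mul (isHomogeneous_binaryForm N M hP hQ))
    have := htransfer hhom (by
      rw [map_sub, map_mul, map_mul, hbN, hbE, mul_left_comm, hNE.2]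
      ring)
    rw [map_sub, map_mul, map_mul, bind₁_X_right, bind₁_X_right, map_binaryForm,
      map_binaryForm] at this
    exact sub_eq_zero.mp this
  · intro h0
    rw [← map_binaryForm] at h0
    rw [hφ, h0, map_zero, map_zero] at hbE
    exact mul_ne_zero (pow_ne_zero M hQ0) hNE.1 hbE.symm

/-! ### Pencils and derivatives along constant directions -/

theorem dvd_monomial_cross {R : Type*} [CommRing R] (p q α β : R) {M k l : ℕ} (hk : k ≤ M)
    (hl : l ≤ M) : β * p - α * q ∣
      p ^ k * q ^ (M - k) * (α ^ l * β ^ (M - l)) - α ^ k * β ^ (M - k) * (p ^ l * q ^ (M - l)) := by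
  rcases le_total k l with h | h
  · obtain ⟨a, rfl⟩ := Nat.exists_eq_add_of_le h
    obtain ⟨c, rfl⟩ := Nat.exists_eq_add_of_le hl
    have h1 : k + a + c - k = a + c := by omega
    have h2 : k + a + c - (k + a) = c := by omega
    rw [h1, h2]
    -- Apart from common monomial factors, the difference is (βp)^a - (αq)^a up to sign.
    obtain ⟨e, he⟩ := sub_dvd_pow_sub_pow (β * p) (α * q) a
    refine ⟨-(p ^ k * α ^ k * q ^ c * β ^ c * e), ?_⟩
    rw [mul_pow, mul_pow] at he
    linear_combination (-(p ^ k * α ^ k * q ^ c * β ^ c)) * he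
  · obtain ⟨a, rfl⟩ := Nat.exists_eq_add_of_le h
    obtain ⟨c, rfl⟩ := Nat.exists_eq_add_of_le hk
    have h1 : l + a + c - l = a + c := by omega
    have h2 : l + a + c - (l + a) = c := by omega
    rw [h1, h2]
    obtain ⟨e, he⟩ := sub_dvd_pow_sub_pow (β * p) (α * q) a
    refine ⟨p ^ l * α ^ l * q ^ c * β ^ c * e, ?_⟩
    rw [mul_pow, mul_pow] at he
    linear_combination (p ^ l * α ^ l * q ^ c * β ^ c) * he

/-- The cross difference vanishes at (p : q) = (α : β), so the corresponding linear form divides it;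
this is checked monomial by monomial. -/
theorem dvd_binaryForm_cross {R : Type*} [CommRing R] [Algebra ℂ R] (N E : Polynomial ℂ) (M : ℕ)
    (p q α β : R) : β * p - α * q ∣
      binaryForm N M p q * binaryForm E M α β - binaryForm N M α β * binaryForm E M p q := by
  rw [binaryForm, binaryForm, binaryForm, binaryForm, Finset.sum_mul_sum, Finset.sum_mul_sum,
    ← Finset.sum_sub_distrib]
  refine Finset.dvd_sum fun k hk => ?_
  rw [← Finset.sum_sub_distrib]
  refine Finset.dvd_sum fun l hl => ?_
  simp only [Finset.mem_range] at hk hl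
  obtain ⟨e, he⟩ := dvd_monomial_cross p q α β (M := M) (k := k) (l := l) (by omega) (by omega)
  refine ⟨algebraMap ℂ R (N.coeff k) * algebraMap ℂ R (E.coeff l) * e, ?_⟩
  linear_combination (algebraMap ℂ R (N.coeff k) * algebraMap ℂ R (E.coeff l)) * he

theorem binaryForm_X_pow {R : Type*} [CommRing R] [Algebra ℂ R] (M : ℕ) (p q : R) :
    binaryForm (Polynomial.X ^ M) M p q = p ^ M := by
  rw [binaryForm, Finset.sum_eq_single M]
  · simp
  · intro k _ hk
    simp [Polynomial.coeff_X_pow, hk]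
  · simp

theorem binaryForm_one {R : Type*} [CommRing R] [Algebra ℂ R] (M : ℕ) (p q : R) :
    binaryForm 1 M p q = q ^ M := by
  rw [binaryForm, Finset.sum_eq_single 0]
  · simp
  · intro k _ hk
    simp [Polynomial.coeff_one, hk]
  · simp

theorem eval_binaryForm (N : Polynomial ℂ) (M : ℕ) (p q : MvPolynomial (Fin n) ℂ)
    (y : Fin n → ℂ) :
    eval y (binaryForm N M p q) = binaryForm N M (eval y p) (eval y q) :=
  map_binaryForm (aeval y) N M p q

theorem binaryForm_C (N : Polynomial ℂ) (M : ℕ) (α β : ℂ) :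
    binaryForm N M (C α : MvPolynomial (Fin n) ℂ) (C β) = C (binaryForm N M α β) :=
  (map_binaryForm (Algebra.ofId ℂ (MvPolynomial (Fin n) ℂ)) N M α β).symm

theorem dirDeriv_C_mul (v : PolyMap n) (c : ℂ) (f : MvPolynomial (Fin n) ℂ) :
    dirDeriv v (C c * f) = C c * dirDeriv v f := by
  rw [Derivation.leibniz, dirDeriv_C, smul_zero, add_zero, smul_eq_mul]

theorem isUnit_C_of_ne_zero {c : ℂ} (hc : c ≠ 0) : IsUnit (C c : MvPolynomial (Fin n) ℂ) :=
  (isUnit_iff_ne_zero.mpr hc).map C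

theorem dvd_of_dvd_mul_C {P f : MvPolynomial (Fin n) ℂ} {c : ℂ} (hc : c ≠ 0)
    (h : P ∣ f * C c) : P ∣ f :=
  (isUnit_C_of_ne_zero hc).dvd_mul_right.mp h

/-- A member of the pencil spanned by `p` and `q` shares no factor with a binary form in `p` and
`q` that does not vanish at the corresponding point. -/
theorem isRelPrime_binaryForm {p q : MvPolynomial (Fin n) ℂ} (hpq : IsRelPrime p q) {α β : ℂ}
    (hf0 : C β * p - C α * q ≠ 0) {E : Polynomial ℂ} {M : ℕ} (hE : binaryForm E M α β ≠ 0) :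
    IsRelPrime (C β * p - C α * q) (binaryForm E M p q) := by
  rw [UniqueFactorizationMonoid.isRelPrime_iff_no_prime_factors hf0]
  intro P hPf hPE hP
  -- A common prime factor divides every binary form of degree M in p and q, in particular p^M and
  -- q^M.
  have key : ∀ N : Polynomial ℂ, P ∣ binaryForm N M p q := by
    intro N
    have h1 := hPf.trans (dvd_binaryForm_cross N E M p q (C α) (C β))
    rw [binaryForm_C, binaryForm_C] at h1
    exact dvd_of_dvd_mul_C hE ((dvd_sub_left (hPE.mul_left _)).mp h1)
  have h1 := key (Polynomial.X ^ M)
  have h2 := key 1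
  rw [binaryForm_X_pow] at h1
  rw [binaryForm_one] at h2
  exact hP.not_isUnit (hpq (hP.dvd_of_dvd_pow h1) (hP.dvd_of_dvd_pow h2))

/-- The pencil member f vanishing at y divides K_i K_{i₀}(y) - K_{i₀} K_i(y). Pairing with the
gradient of f and using D_K f = 0 gives f ∣ K_{i₀} D_{K(y)} f. A common prime factor of f and K_{i₀}
would divide all of K, so f ∣ D_{K(y)} f, which vanishes for degree reasons. -/
theorem dirDeriv_pencil_eq_zero {K : PolyMap n} (hgcd : GcdEqOne K) {i₀ : Fin n}
    {p q : MvPolynomial (Fin n) ℂ} (hpq : IsRelPrime p q) {r : ℕ} (hr : r ≠ 0)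
    (hp : p.IsHomogeneous r) (hq : q.IsHomogeneous r)
    {M : Fin n → ℕ} {N E : Fin n → Polynomial ℂ}
    (hrel : ∀ i, K i * binaryForm (E i) (M i) p q = K i₀ * binaryForm (N i) (M i) p q)
    (hdp : dirDeriv K p = 0) (hdq : dirDeriv K q = 0) {y : Fin n → ℂ}
    (hy₀ : eval y (K i₀) ≠ 0) (hyq : eval y q ≠ 0)
    (hyE : ∀ i, eval y (binaryForm (E i) (M i) p q) ≠ 0) :
    C (eval y p) * q - C (eval y q) * p ≠ 0 ∧
    C (eval y q) * dirDeriv (fun i => C (eval y (K i))) p =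
      C (eval y p) * dirDeriv (fun i => C (eval y (K i))) q := by
  set α := eval y p with hα
  set β := eval y q with hβ
  set f := C β * p - C α * q with hf
  have hfhom : f.IsHomogeneous r := (hp.C_mul β).sub (hq.C_mul α)
  have hf0 : f ≠ 0 := by
    intro h0
    have hqp : q ∣ p := by
      refine (isUnit_C_of_ne_zero hyq).dvd_mul_left.mp ⟨C α, ?_⟩
      linear_combination h0
    have hu := hpq hqp dvd_rfl
    have h1 := totalDegree_le_of_dvd_of_isDomain hu.dvd
      (one_ne_zero (α := MvPolynomial (Fin n) ℂ))
    rw [hq.totalDegree hu.ne_zero, totalDegree_one] at h1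
    omega
  have hdiv : ∀ i, f ∣ K i * C (eval y (K i₀)) - K i₀ * C (eval y (K i)) := by
    intro i
    have hE := hyE i
    rw [eval_binaryForm] at hE
    have hcross := dvd_binaryForm_cross (N i) (E i) (M i) p q (C α) (C β)
    rw [binaryForm_C, binaryForm_C] at hcross
    have hrely := congrArg (eval y) (hrel i)
    rw [map_mul, map_mul, eval_binaryForm, eval_binaryForm] at hrely
    have hrelC := congrArg (C : ℂ → MvPolynomial (Fin n) ℂ) hrely
    rw [C_mul, C_mul] at hrelC
    obtain ⟨e, he⟩ := hcross
    refine (isRelPrime_binaryForm hpq hf0 hE).dvd_of_dvd_mul_right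
      (dvd_of_dvd_mul_C hE ⟨K i₀ * C (eval y (K i₀)) * e, ?_⟩)
    linear_combination (K i₀ * C (eval y (K i₀))) * he +
      C (eval y (K i₀)) * C (binaryForm (E i) (M i) α β) * hrel i -
      K i₀ * binaryForm (E i) (M i) p q * hrelC
  have hrp : IsRelPrime f (K i₀) := by
    rw [UniqueFactorizationMonoid.isRelPrime_iff_no_prime_factors hf0]
    intro P hPf hPK hP
    refine hP.not_isUnit (hgcd P fun i => dvd_of_dvd_mul_C hy₀ ?_)
    exact (dvd_sub_left (hPK.mul_right _)).mp (hPf.trans (hdiv i))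
  have hKf : dirDeriv K f = 0 := by
    rw [hf, map_sub, dirDeriv_C_mul, dirDeriv_C_mul, hdp, hdq]
    simp
  have hdvd : f ∣ K i₀ * dirDeriv (fun i => C (eval y (K i))) f := by
    have h1 : f ∣ ∑ i, (K i * C (eval y (K i₀)) - K i₀ * C (eval y (K i))) * pderiv i f :=
      Finset.dvd_sum fun i _ => (hdiv i).mul_right _
    have h2 : ∑ i, (K i * C (eval y (K i₀)) - K i₀ * C (eval y (K i))) * pderiv i f =
        C (eval y (K i₀)) * dirDeriv K f -
          K i₀ * dirDeriv (fun i => C (eval y (K i))) f := by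
      rw [dirDeriv_apply, dirDeriv_apply, Finset.mul_sum, Finset.mul_sum,
        ← Finset.sum_sub_distrib]
      refine Finset.sum_congr rfl fun i _ => ?_
      ring
    rw [h2, hKf, mul_zero, zero_sub, dvd_neg] at h1
    exact h1
  have hD0 := eq_zero_of_dvd_of_isHomogeneous hfhom hf0 (isHomogeneous_dirDeriv_C _ hfhom)
    (by omega) (hrp.dvd_of_dvd_mul_left hdvd)
  refine ⟨?_, ?_⟩
  · rw [← neg_sub]
    exact neg_ne_zero.mpr hf0
  · rw [hf, map_sub, dirDeriv_C_mul, dirDeriv_C_mul, sub_eq_zero] at hD0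
    exact hD0

/-- The constant directions in which the derivative of `f` vanishes. -/
def dirKer (f : MvPolynomial (Fin n) ℂ) : Submodule ℂ (Fin n → ℂ) where
  carrier := {u | dirDeriv (fun i => C (u i)) f = 0}
  zero_mem' := by
    rw [Set.mem_ofPred_eq, dirDeriv_apply]
    simp
  add_mem' {u w} hu hw := by
    rw [Set.mem_ofPred_eq, dirDeriv_apply] at *
    simp only [Pi.add_apply, C_add, add_mul, Finset.sum_add_distrib]
    rw [hu, hw, add_zero]
  smul_mem' c u hu := by
    rw [Set.mem_ofPred_eq, dirDeriv_apply] at *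
    simp only [Pi.smul_apply, smul_eq_mul, C_mul, mul_assoc]
    rw [← Finset.mul_sum, hu, mul_zero]

theorem mem_dirKer {f : MvPolynomial (Fin n) ℂ} {u : Fin n → ℂ} :
    u ∈ dirKer f ↔ dirDeriv (fun i => C (u i)) f = 0 := Iff.rfl

/-- For fixed x the condition is polynomial in y, so it extends from the set s ≠ 0 to all y. -/
theorem mem_dirKer_of_generic {K : PolyMap n} {s f : MvPolynomial (Fin n) ℂ} (hs : s ≠ 0)
    (h : ∀ y, eval y s ≠ 0 → (fun i => eval y (K i)) ∈ dirKer f) (y : Fin n → ℂ) :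
    (fun i => eval y (K i)) ∈ dirKer f := by
  rw [mem_dirKer]
  refine MvPolynomial.funext fun x => ?_
  have hP : (∑ i, K i * C (eval x (pderiv i f))) * s = 0 := by
    refine MvPolynomial.funext fun z => ?_
    by_cases hz : eval z s = 0
    · rw [map_mul, hz, mul_zero, map_zero]
    · have := congrArg (eval x) (mem_dirKer.mp (h z hz))
      rw [dirDeriv_apply] at this
      simp only [map_sum, map_mul, eval_C, map_zero] at this ⊢
      rw [this, zero_mul]
  have hQ := congrArg (eval y) ((mul_eq_zero.mp hP).resolve_right hs)
  rw [dirDeriv_apply]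
  simpa using hQ

/-- With l(e) = 1, the projection x - l(x)e lands in the kernel, so substituting it kills f; yet it
is the identity modulo the linear form. -/
theorem dvd_of_eval_eq_zero_on_ker {l : Module.Dual ℂ (Fin n → ℂ)} (hl : l ≠ 0)
    {f : MvPolynomial (Fin n) ℂ} (hf : ∀ y, l y = 0 → eval y f = 0) :
    (∑ i, C (l (Pi.single i 1)) * X i) ∣ f := by
  set L : MvPolynomial (Fin n) ℂ := ∑ i, C (l (Pi.single i 1)) * X i with hL
  have hev : ∀ y, eval y L = l y := by
    intro y
    conv_rhs => rw [pi_eq_sum_univ' y]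
    simp [L, mul_comm]
  obtain ⟨e, he⟩ : ∃ e, l e = 1 := by
    obtain ⟨e, he⟩ : ∃ e, l e ≠ 0 := by
      by_contra! h
      exact hl (LinearMap.ext h)
    exact ⟨(l e)⁻¹ • e, by simp [he]⟩
  have h0 : bind₁ (fun i => X i - C (e i) * L) f = 0 := by
    refine MvPolynomial.funext fun y => ?_
    rw [eval_bind₁, map_zero]
    apply hf
    have : (fun i => eval y (X i - C (e i) * L)) = y - l y • e := by
      ext i
      simp [hev, mul_comm]
    rw [this, map_sub, map_smul, he]
    simp
  rw [← Ideal.mem_span_singleton, ← Ideal.Quotient.eq_zero_iff_mem]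
  have h1 : (Ideal.Quotient.mkₐ ℂ (Ideal.span {L})).comp (bind₁ fun i => X i - C (e i) * L) =
      Ideal.Quotient.mkₐ ℂ (Ideal.span {L}) := by
    ext i
    rw [AlgHom.comp_apply, bind₁_X_right, Ideal.Quotient.mkₐ_eq_mk, Ideal.Quotient.eq,
      Ideal.mem_span_singleton]
    exact ⟨-C (e i), by ring⟩
  have h2 := congrArg (fun φ => φ f) h1
  simp only [AlgHom.comp_apply, h0, map_zero] at h2
  exact h2.symm

/-- Coprime polynomials without constant term cannot vanish on a common hyperplane. -/
theorem finrank_add_two_le_of_isRelPrime {p q : MvPolynomial (Fin n) ℂ} (hpq : IsRelPrime p q)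
    (hq0 : q ≠ 0) {U : Submodule ℂ (Fin n → ℂ)} (hp : ∀ u ∈ U, eval u p = 0)
    (hq : ∀ u ∈ U, eval u q = 0) : Module.finrank ℂ U + 2 ≤ n := by
  have hfr := Subspace.finrank_add_finrank_dualAnnihilator_eq U
  rw [Module.finrank_fin_fun] at hfr
  by_contra! hlt
  have hA : Module.finrank ℂ U.dualAnnihilator ≤ 1 := by omega
  obtain ⟨⟨l, hlU⟩, hl⟩ := finrank_le_one_iff.mp hA
  have hker : ∀ y, l y = 0 → y ∈ U := by
    intro y hy
    rw [← Subspace.forall_mem_dualAnnihilator_apply_eq_zero_iff]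
    intro φ hφ
    obtain ⟨c, hc⟩ := hl ⟨φ, hφ⟩
    have hc' : c • l = φ := congrArg Subtype.val hc
    rw [← hc', LinearMap.smul_apply, hy, smul_zero]
  have hl0 : l ≠ 0 := by
    rintro rfl
    exact hq0 (MvPolynomial.funext fun y => by rw [hq y (hker y rfl), map_zero])
  have hu := hpq (dvd_of_eval_eq_zero_on_ker hl0 fun y hy => hp y (hker y hy))
    (dvd_of_eval_eq_zero_on_ker hl0 fun y hy => hq y (hker y hy))
  have hhom : (∑ i, C (l (Pi.single i 1)) * X i : MvPolynomial (Fin n) ℂ).IsHomogeneous 1 :=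
    IsHomogeneous.sum _ _ _ fun i _ => (isHomogeneous_X ℂ i).C_mul _
  have h1 := totalDegree_le_of_dvd_of_isDomain hu.dvd (one_ne_zero (α := MvPolynomial (Fin n) ℂ))
  rw [hhom.totalDegree hu.ne_zero, totalDegree_one] at h1
  omega

/-- For r ≥ 2, linearity in both directions gives D_u D_u f = 0, whose value at u is r(r - 1)f(u) by
Euler. For r = 1, D_{K(y)} f is a constant, equal to its value (D_K f)(y) = 0. -/
theorem eval_eq_zero_of_second_derivatives {K : PolyMap n} {f : MvPolynomial (Fin n) ℂ} {r : ℕ}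
    (hr : r ≠ 0) (hf : f.IsHomogeneous r) (hdf : dirDeriv K f = 0)
    (h2 : ∀ y z, (fun i => eval y (K i)) ∈
      dirKer (dirDeriv (fun i => C (eval z (K i))) f)) {u : Fin n → ℂ}
    (hu : u ∈ Submodule.span ℂ (Set.range fun y i => eval y (K i))) : eval u f = 0 := by
  rcases Nat.lt_or_ge 1 r with h1 | h1
  · have hle1 : ∀ z, Submodule.span ℂ (Set.range fun y i => eval y (K i)) ≤
        dirKer (dirDeriv (fun i => C (eval z (K i))) f) := by
      intro z
      rw [Submodule.span_le]
      rintro _ ⟨y, rfl⟩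
      exact h2 y z
    have hle2 : Submodule.span ℂ (Set.range fun y i => eval y (K i)) ≤
        dirKer (dirDeriv (fun i => C (u i)) f) := by
      rw [Submodule.span_le]
      rintro _ ⟨z, rfl⟩
      have := mem_dirKer.mp (hle1 z hu)
      rw [dirDeriv_C_comm] at this
      exact this
    have h3 := congrArg (eval u) (mem_dirKer.mp (hle2 hu))
    rw [eval_dirDeriv_C_self u (isHomogeneous_dirDeriv_C u hf), eval_dirDeriv_C_self u hf,
      map_zero] at h3
    have e1 : ((r - 1 : ℕ) : ℂ) ≠ 0 := Nat.cast_ne_zero.mpr (by omega)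
    have e2 : (r : ℂ) ≠ 0 := Nat.cast_ne_zero.mpr hr
    exact ((mul_eq_zero.mp h3).resolve_left e1 |> mul_eq_zero.mp).resolve_left e2
  · obtain rfl : r = 1 := by omega
    have hle : Submodule.span ℂ (Set.range fun y i => eval y (K i)) ≤ dirKer f := by
      rw [Submodule.span_le]
      rintro _ ⟨y, rfl⟩
      obtain ⟨c, hc⟩ := exists_eq_C_of_isHomogeneous_zero
        (isHomogeneous_dirDeriv_C (fun i => eval y (K i)) hf)
      have h3 := congrArg (eval y) hdf
      rw [eval_dirDeriv, hc, eval_C, map_zero] at h3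
      change dirDeriv (fun i => C (eval y (K i))) f = 0
      rw [hc, h3, C_0]
    have h3 := congrArg (eval u) (mem_dirKer.mp (hle hu))
    rw [eval_dirDeriv_C_self u hf, map_zero] at h3
    simpa using h3

/-- The image of `K` lies in a subspace of codimension two. -/
theorem exists_submodule_of_pencil {K : PolyMap n} (hgcd : GcdEqOne K) {i₀ : Fin n}
    (h₀ : K i₀ ≠ 0) {p q : MvPolynomial (Fin n) ℂ} (hpq : IsRelPrime p q) (hq0 : q ≠ 0) {r : ℕ}
    (hr : r ≠ 0) (hp : p.IsHomogeneous r) (hq : q.IsHomogeneous r)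
    (hrel : ∀ i, ∃ (M : ℕ) (N E : Polynomial ℂ),
      K i * binaryForm E M p q = K i₀ * binaryForm N M p q ∧ binaryForm E M p q ≠ 0)
    (hdp : dirDeriv K p = 0) (hdq : dirDeriv K q = 0) :
    ∃ U : Submodule ℂ (Fin n → ℂ), (∀ y, (fun i => eval y (K i)) ∈ U) ∧
      Module.finrank ℂ U + 2 ≤ n := by
  choose M N E hrel hE using hrel
  -- All genericity conditions on a point are collected in the nonvanishing of one polynomial.
  set s : MvPolynomial (Fin n) ℂ := K i₀ * q * ∏ i, binaryForm (E i) (M i) p q with hs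
  have hs0 : s ≠ 0 := mul_ne_zero (mul_ne_zero h₀ hq0) (Finset.prod_ne_zero_iff.mpr fun i _ => hE i)
  have hgen : ∀ y, eval y s ≠ 0 → C (eval y p) * q - C (eval y q) * p ≠ 0 ∧
      C (eval y q) * dirDeriv (fun i => C (eval y (K i))) p =
        C (eval y p) * dirDeriv (fun i => C (eval y (K i))) q := by
    intro y hy
    rw [hs, map_mul, map_mul, map_prod] at hy
    exact dirDeriv_pencil_eq_zero hgcd hpq hr hp hq hrel hdp hdq
      (left_ne_zero_of_mul (left_ne_zero_of_mul hy)) (right_ne_zero_of_mul (left_ne_zero_of_mul hy))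
      fun i => Finset.prod_ne_zero_iff.mp (right_ne_zero_of_mul hy) i (Finset.mem_univ i)
  have hpair : ∀ y z, eval y s ≠ 0 → eval z s ≠ 0 →
      eval z p * eval y q - eval z q * eval y p ≠ 0 →
      dirDeriv (fun i => C (eval y (K i))) (dirDeriv (fun i => C (eval z (K i))) p) = 0 ∧
      dirDeriv (fun i => C (eval y (K i))) (dirDeriv (fun i => C (eval z (K i))) q) = 0 := by
    intro y z hy hz hdet
    -- Differentiating the relation at z along K(y) and the one at y along K(z) gives a linear
    -- system for the mixed derivatives of p and q, with determinant nonzero by `hdet`.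
    have e1 := congrArg (dirDeriv fun i => C (eval y (K i))) (hgen z hz).2
    have e2 := congrArg (dirDeriv fun i => C (eval z (K i))) (hgen y hy).2
    rw [dirDeriv_C_mul, dirDeriv_C_mul] at e1 e2
    rw [dirDeriv_C_comm, dirDeriv_C_comm _ _ q] at e2
    have hdet' : (C (eval z p * eval y q - eval z q * eval y p) : MvPolynomial (Fin n) ℂ) ≠ 0 :=
      (isUnit_C_of_ne_zero hdet).ne_zero
    rw [C_sub, C_mul, C_mul] at hdet'
    constructor
    · apply mul_left_cancel₀ hdet'
      rw [mul_zero]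
      linear_combination C (eval z p) * e2 - C (eval y p) * e1
    · apply mul_left_cancel₀ hdet'
      rw [mul_zero]
      linear_combination C (eval z q) * e2 - C (eval y q) * e1
  have hall : ∀ y z, (fun i => eval y (K i)) ∈
        dirKer (dirDeriv (fun i => C (eval z (K i))) p) ∧
      (fun i => eval y (K i)) ∈ dirKer (dirDeriv (fun i => C (eval z (K i))) q) := by
    -- Genericity is removed first in y and then, by symmetry of the mixed derivatives, in z.
    have hfst : ∀ z, eval z s ≠ 0 → ∀ y, (fun i => eval y (K i)) ∈
        dirKer (dirDeriv (fun i => C (eval z (K i))) p) ∧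
        (fun i => eval y (K i)) ∈ dirKer (dirDeriv (fun i => C (eval z (K i))) q) := by
      intro z hz y
      have hne := mul_ne_zero hs0 (hgen z hz).1
      have hy : ∀ y, eval y (s * (C (eval z p) * q - C (eval z q) * p)) ≠ 0 → eval y s ≠ 0 ∧
          eval z p * eval y q - eval z q * eval y p ≠ 0 := by
        intro y hy
        simp only [map_mul, map_sub, eval_C] at hy
        exact ⟨left_ne_zero_of_mul hy, right_ne_zero_of_mul hy⟩
      exact ⟨mem_dirKer_of_generic hne (fun y h => (hpair y z (hy y h).1 hz (hy y h).2).1) y,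
        mem_dirKer_of_generic hne (fun y h => (hpair y z (hy y h).1 hz (hy y h).2).2) y⟩
    intro y z
    simp only [mem_dirKer]
    rw [dirDeriv_C_comm, dirDeriv_C_comm _ _ q]
    constructor
    · refine mem_dirKer_of_generic hs0 (fun z hz => ?_) z
      rw [mem_dirKer, dirDeriv_C_comm]
      exact (hfst z hz y).1
    · refine mem_dirKer_of_generic hs0 (fun z hz => ?_) z
      rw [mem_dirKer, dirDeriv_C_comm]
      exact (hfst z hz y).2
  refine ⟨Submodule.span ℂ (Set.range fun y i => eval y (K i)),
    fun y => Submodule.subset_span ⟨y, rfl⟩, ?_⟩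
  exact finrank_add_two_le_of_isRelPrime hpq hq0
    (fun u hu => eval_eq_zero_of_second_derivatives hr hp hdp (fun y z => (hall y z).1) hu)
    (fun u hu => eval_eq_zero_of_second_derivatives hr hq hdq (fun y z => (hall y z).2) hu)

/-! ### Reduction to coprime components and the case of rank two -/

/-- Every nonzero polynomial map is a polynomial multiple of one with coprime components. -/
theorem exists_eq_mul_gcdEqOne {i₀ : Fin n} (H : PolyMap n) (h₀ : H i₀ ≠ 0) :
    ∃ (g : MvPolynomial (Fin n) ℂ) (K : PolyMap n), (∀ i, H i = g * K i) ∧ GcdEqOne K := by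
  induction hk : (H i₀).totalDegree using Nat.strong_induction_on generalizing H with
  | _ k ih =>
    by_cases hgcd : GcdEqOne H
    · exact ⟨1, H, fun i => (one_mul _).symm, hgcd⟩
    · rw [GcdEqOne] at hgcd
      push Not at hgcd
      obtain ⟨g, hdvd, hu⟩ := hgcd
      choose K hK using hdvd
      have h0 : g * K i₀ ≠ 0 := hK i₀ ▸ h₀
      have hg : g.totalDegree ≠ 0 := by
        intro h
        rw [totalDegree_eq_zero_iff_eq_C] at h
        refine hu (h ▸ isUnit_C_of_ne_zero fun hc => ?_)
        rw [h, hc, C_0, zero_mul] at h0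
        exact h0 rfl
      have hdeg := totalDegree_mul_of_isDomain (left_ne_zero_of_mul h0) (right_ne_zero_of_mul h0)
      rw [← hK i₀, hk] at hdeg
      obtain ⟨g', K', hK', hgcd'⟩ := ih _ (by omega) K (right_ne_zero_of_mul h0) rfl
      exact ⟨g * g', K', fun i => by rw [hK, hK', mul_assoc], hgcd'⟩

theorem rankJacobian_le_one_of_eq_C_mul {H : PolyMap n} {i₀ : Fin n}
    (h : ∀ j, ∃ c, H j = C c * H i₀) : rankJacobian H ≤ 1 := by
  rw [rankJacobian_eq_finrank]
  refine le_trans (Submodule.finrank_mono (Submodule.span_le.mpr ?_ :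
    _ ≤ Submodule.span _ {grad (H i₀)})) ((finrank_span_le_card _).trans (by simp))
  rintro _ ⟨j, rfl⟩
  obtain ⟨c, hc⟩ := h j
  rw [SetLike.mem_coe, Submodule.mem_span_singleton]
  refine ⟨algebraMap _ _ (C c : MvPolynomial (Fin n) ℂ), ?_⟩
  change _ = grad (H j)
  rw [hc, grad_mul, grad_C, smul_zero, add_zero]

theorem shiftHom_bind₁ {H : PolyMap n} (hH : ∀ i, shiftHom H (H i) = Polynomial.C (H i))
    (P : MvPolynomial (Fin n) ℂ) : shiftHom H (bind₁ H P) = Polynomial.C (bind₁ H P) := by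
  have : (shiftHom H).comp (bind₁ H) = (Polynomial.CAlgHom).comp (bind₁ H) := by
    ext1 i
    rw [AlgHom.comp_apply, AlgHom.comp_apply, bind₁_X_right, hH]
    rfl
  exact congrArg (fun φ => φ P) this

theorem hasIndependentLinearInvariants_two {H : PolyMap n} (hqt : IsQuasiTranslation H) {d : ℕ}
    (hd : d ≠ 0) (hH : ∀ i, (H i).IsHomogeneous d) {i₀ : Fin n} (h₀ : H i₀ ≠ 0)
    (hr2 : rankJacobian H = 2) : HasIndependentLinearInvariants H 2 := by
  obtain ⟨j₀, hj₀⟩ : ∃ j, ∀ c, H j ≠ C c * H i₀ := by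
    by_contra! hcon
    have := rankJacobian_le_one_of_eq_C_mul hcon
    omega
  -- The line is chosen so that `H i₀` and `H j₀` stay nonproportional on it.
  obtain ⟨a, b, hab⟩ : ∃ a b, eval a (H i₀) * eval b (H j₀) ≠ eval a (H j₀) * eval b (H i₀) := by
    by_contra! hcon
    obtain ⟨a, ha⟩ : ∃ a, eval a (H i₀) ≠ 0 := by
      by_contra! h
      exact h₀ (MvPolynomial.funext fun y => by rw [h, map_zero])
    refine hj₀ (eval a (H j₀) / eval a (H i₀)) (MvPolynomial.funext fun b => ?_)
    rw [map_mul, eval_C, div_mul_eq_mul_div, eq_div_iff ha, ← hcon a b, mul_comm]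
  obtain ⟨m, P, Q, hP, hQ, hQ0, hrel⟩ := exists_binaryForm hd hH hr2.le hab
  have hPhom := isHomogeneous_bind₁ hH hP
  have hQhom := isHomogeneous_bind₁ hH hQ
  have hPinv := shiftHom_bind₁ hqt.shiftHom_eq P
  have hQinv := shiftHom_bind₁ hqt.shiftHom_eq Q
  generalize bind₁ H P = P' at *
  generalize bind₁ H Q = Q' at *
  obtain ⟨p, q, g, hpq, rfl, rfl⟩ := UniqueFactorizationMonoid.exists_reduced_factors' P' Q' hQ0
  have hg0 : g ≠ 0 := left_ne_zero_of_mul hQ0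
  have hq0 : q ≠ 0 := right_ne_zero_of_mul hQ0
  obtain ⟨e, r, her, hge, hq⟩ := exists_isHomogeneous_of_mul hQhom hQ0
  have hp : p.IsHomogeneous r := by
    by_cases hp0 : p = 0
    · rw [hp0]
      exact isHomogeneous_zero _ _ _
    · obtain ⟨e', r', her', hge', hp⟩ := exists_isHomogeneous_of_mul hPhom (mul_ne_zero hg0 hp0)
      have := hge.inj_right hge' hg0
      obtain rfl : r = r' := by omega
      exact hp
  rw [mul_comm] at hQinv hQ0
  -- q is a factor of the invariant Q(H), hence itself invariant; likewise p below, unless it is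
  -- zero.
  have hqD : dirDeriv H q = 0 := dirDeriv_eq_zero_of_shiftHom (shiftHom_eq_C_of_mul hQinv hQ0)
  have hpD : dirDeriv H p = 0 := by
    by_cases hp0 : p = 0
    · rw [hp0, map_zero]
    · rw [mul_comm] at hPinv
      exact dirDeriv_eq_zero_of_shiftHom (shiftHom_eq_C_of_mul hPinv (mul_ne_zero hp0 hg0))
  obtain ⟨γ, K, hK, hgcd⟩ := exists_eq_mul_gcdEqOne H h₀
  have hγ0 : γ ≠ 0 := by
    rintro rfl
    exact h₀ (by rw [hK, zero_mul])
  have hK0 : K i₀ ≠ 0 := by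
    intro h
    exact h₀ (by rw [hK, h, mul_zero])
  have hKD : ∀ f, dirDeriv H f = 0 → dirDeriv K f = 0 := by
    intro f hf
    rw [dirDeriv_apply] at hf ⊢
    simp only [hK, mul_assoc] at hf
    rw [← Finset.mul_sum] at hf
    exact (mul_eq_zero.mp hf).resolve_left hγ0
  have hrelK : ∀ i, ∃ (M : ℕ) (N E : Polynomial ℂ),
      K i * binaryForm E M p q = K i₀ * binaryForm N M p q ∧ binaryForm E M p q ≠ 0 := by
    intro i
    obtain ⟨M, N, E, h1, h2⟩ := hrel i
    rw [binaryForm_mul] at h2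
    refine ⟨M, N, E, ?_, right_ne_zero_of_mul h2⟩
    rw [binaryForm_mul, binaryForm_mul, hK i, hK i₀] at h1
    apply mul_left_cancel₀ (mul_ne_zero hγ0 (pow_ne_zero M hg0))
    linear_combination h1
  -- If p and q were constants, so would be the binary forms, making `H j₀` a multiple of `H i₀`.
  have hr : r ≠ 0 := by
    rintro rfl
    obtain ⟨M, N, E, h1, h2⟩ := hrelK j₀
    obtain ⟨ν, hν⟩ := exists_eq_C_of_isHomogeneous_zero
      ((zero_mul M) ▸ isHomogeneous_binaryForm N M hp hq)
    obtain ⟨ε, hε⟩ := exists_eq_C_of_isHomogeneous_zero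
      ((zero_mul M) ▸ isHomogeneous_binaryForm E M hp hq)
    rw [hε] at h2
    have hε0 : ε ≠ 0 := by
      rintro rfl
      exact h2 C_0
    rw [hν, hε] at h1
    apply hj₀ (ν / ε)
    apply mul_left_cancel₀ h2
    rw [← mul_assoc, ← C_mul, mul_div_cancel₀ _ hε0, hK j₀, hK i₀]
    linear_combination γ * h1
  obtain ⟨U, hU, hfr⟩ := exists_submodule_of_pencil hgcd hK0 hpq hq0 hr hp hq hrelK
    (hKD p hpD) (hKD q hqD)
  refine hasIndependentLinearInvariants_of_finrank U (fun y => ?_) hfr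
  have : (fun i => eval y (H i)) = eval y γ • fun i => eval y (K i) := by
    ext i
    simp [hK]
  rw [this]
  exact U.smul_mem _ (hU y)

end QuasiTranslation

end

theorem mainTheorem8 (n : ℕ) (H : QuasiTranslation.PolyMap n)
    (hqt : QuasiTranslation.IsQuasiTranslation H)
    (hhom : QuasiTranslation.IsHomogeneousMap H)
    (hdeg : 1 ≤ QuasiTranslation.degree H) :
    (QuasiTranslation.rankJacobian H ≤ 1 →
      (∃ L : Submodule ℂ (Fin n → ℂ), Module.finrank ℂ L = 1 ∧
        QuasiTranslation.image H = (L : Set (Fin n → ℂ))) ∧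
      QuasiTranslation.HasIndependentLinearInvariants H (n - 1)) ∧
    (QuasiTranslation.GcdEqOne H →
      2 ≤ QuasiTranslation.rankJacobian H ∧
      (QuasiTranslation.rankJacobian H : WithBot ℕ∞) ≤
        QuasiTranslation.dim (QuasiTranslation.zeroSet H) ∧
      QuasiTranslation.dim (QuasiTranslation.zeroSet H) + 2 ≤ (n : WithBot ℕ∞)) ∧
    (QuasiTranslation.rankJacobian H = 2 →
      QuasiTranslation.HasIndependentLinearInvariants H 2) := by
  obtain ⟨d, hH⟩ := hhom
  obtain ⟨hd, i₀, h₀⟩ := QuasiTranslation.exists_ne_zero_of_one_le_degree hdeg hH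
  exact ⟨fun hr => QuasiTranslation.image_eq_line_of_rankJacobian_le_one hd hH hr h₀,
    fun hgcd => ⟨QuasiTranslation.two_le_rankJacobian_of_gcdEqOne hd hH h₀ hgcd,
      QuasiTranslation.rankJacobian_le_dim_zeroSet hqt hd hH,
      QuasiTranslation.dim_zeroSet_add_two_le h₀ hgcd⟩,
    QuasiTranslation.hasIndependentLinearInvariants_two hqt hd hH h₀⟩
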